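/- For an integer $n\ge 1$ let $p_1(n)<p_2(n)<\dots<p_{\omega(n)}(n)$ be its distinct prime factors, and put $$f(n):=\max_{1\le j<\omega(n)}\log\Big(\frac{\log p_{j+1}(n)}{\log p_j(n)}\Big),$$ with the convention $f(n)=0$ when $\omega(n)\le 1$. Let $\log_k$ denote the $k$-fold iterated natural logarithm. A set $A$ of positive integers has asymptotic density $d$ if $\frac1N\,\#\{n\le N: n\in A\}\to d$ as $N\to\infty$, and a property holds for almost all $n$ if the set of positive integers $n$ having it has asymptotic density $1$. **Theorem (Erdős).** For every real $c>0$, the set of positive integers $n$ with $f(n)>\log_3 n-\log(1/c)$ has asymptotic density $1-e^{-1/c}$. For $n\ge 3$ this inequality is equivalent to $e^{f(n)}>c\log_2 n$, so the set of $n$ satisfying the latter also has asymptotic density $1-e^{-1/c}$. Consequently, for every real-valued function $\xi$ on the positive integers with $\xi(n)\to\infty$ as $n\to\infty$, $$\log_3 n-\xi(n)\le f(n)\le \log_3 n+\xi(n)$$ holds for almost all $n$. (The finitely many small $n$ for which an iterated logarithm is undefined do not affect these assertions about density.) -/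

import Mathlib

open Filter Topology

noncomputable section

/-- `kthPrimeFactor j n` is `p_j(n)`, the `j`-th smallest (`j = 1, 2, ...`) element of the set of
distinct prime factors of `n`. It is meaningful for `1 ≤ j ≤ ω(n)`. -/
def kthPrimeFactor (j n : ℕ) : ℕ :=
  Nat.nth (fun p => p ∈ n.primeFactors) (j - 1)

/-- `maxLogGap n` is the maximum over `1 ≤ j < ω(n)` of `log (log p_{j+1}(n) / log p_j(n))`.
When `ω(n) ≤ 1` there is no such `j`, and the value is `0` by convention. -/
def maxLogGap (n : ℕ) : ℝ :=
  if h : (Finset.Ico 1 n.primeFactors.card).Nonempty then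
    (Finset.Ico 1 n.primeFactors.card).sup' h fun j =>
      Real.log (Real.log (kthPrimeFactor (j + 1) n) / Real.log (kthPrimeFactor j n))
  else 0

/-- `iterLog k x` is `log_k x`, the `k`-fold iterated logarithm. -/
def iterLog (k : ℕ) (x : ℝ) : ℝ :=
  Real.log^[k] x

/-- The set of positive integers belonging to `A` has asymptotic (natural) density `d`:
`#{n ∈ A : 1 ≤ n ≤ N} / N → d` as `N → ∞`. -/
def HasAsymptoticDensity (A : Set ℕ) (d : ℝ) : Prop :=
  Tendsto (fun N : ℕ => ((A ∩ Set.Icc 1 N).ncard : ℝ) / N) atTop (𝓝 d)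

/-- A property holds for almost all positive integers: the set where it holds has density `1`. -/
def HoldsForAlmostAll (P : ℕ → Prop) : Prop :=
  HasAsymptoticDensity {n | P n} 1

end

/-!
Write `L = log log N` and call a prime factor `p` of `n` the start of a gap when no prime in
`(p, p ^ T]` divides `n`. For `T ≥ 1`, `exp (maxLogGap n) > T` says that such a start exists below
the largest prime factor of `n` (`lt_exp_maxLogGap_iff`). With `T ~ c L` the claim is that this
happens for a proportion `1 - exp (-1 / c) + o(1)` of the `n ≤ N` (`tendsto_natProb_hasGap`).

*The independent model.* Suppose each prime `p` is selected independently with probability `1 / p`.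
By Mertens' theorem, `p` starts a gap with probability `gapWeight T p ~ 1 / (p T)`, so the expected
number of starts is about `L / T`, which tends to `1 / c`. Let `H u` be the probability that no
start exceeds `u`. Conditioning on the last start `p` gives the exact renewal equation
`H (p - 1) = H p - gapWeight T p * H (p ^ T)` (`modelProb_noGapStart_pred`): a start at `p` excludes
every start in `(p, p ^ T]`, and is independent of what happens beyond `p ^ T`. As `H (p ^ T)`
exceeds `H p` by at most the probability of a start in `(p, p ^ T]`, which is `O(log T / T)`, the
solution is `∏ (1 - gapWeight T p) + o(1)`, which tends to `exp (-1 / c)`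
(`tendsto_modelProb_noGapStart`).

*From integers to the model.* For the primes up to `N ^ (L ^ (-3 / 2))`, Brun's pure sieve bounds
from below the number of `n ≤ N` whose prime factors in that range form a given set. Since both
distributions have total mass one, lower bounds alone make them close in total variation
(`abs_natProb_sub_modelProb_le`, `tendsto_modelError`).

*Large starts.* The model covers the starts `p ≤ N ^ (L ^ (-3))`, and larger starts are negligible.
If `p > N ^ (L ^ (-1 / 2))` then `p ^ T > N`. A start `p` with
`N ^ (L ^ (-(k + 1) / 2)) < p ≤ N ^ (L ^ (-k / 2))`, where `1 ≤ k ≤ 5`, forces `n` to avoid all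
primes in a window whose endpoints have logarithms with ratio `L ^ (1 / 4)`. The reciprocals of the
primes in that window have an unbounded sum as `N` grows, so by Turán's variance bound almost no `n`
avoids them (`tendsto_natProb_window_empty`, `hasGap_iff_not_noGapStart`).

The threshold `c log log n` differs from `c L` by a bounded amount for `√N < n ≤ N`, which the
freedom in `T ~ c L` absorbs. The bounds for almost all `n` follow by letting `c` tend to `0` and
to `∞`.
-/

/-! ### Mertens' theorems on intervals -/

/-- The primes in `(u, v]`. -/
def primesIoc (u v : ℕ) : Finset ℕ := {p ∈ Finset.Ioc u v | p.Prime}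

theorem mem_primesIoc {u v p : ℕ} : p ∈ primesIoc u v ↔ (u < p ∧ p ≤ v) ∧ p.Prime := by
  simp [primesIoc]

/-- The sum of `1 / p` over the primes `p` in `(u, v]`. -/
noncomputable def recipSum (u v : ℕ) : ℝ := ∑ p ∈ primesIoc u v, 1 / (p : ℝ)

theorem sum_primesIoc_eq_sum_ite (f : ℕ → ℝ) (u v : ℕ) :
    ∑ p ∈ primesIoc u v, f p = ∑ n ∈ Finset.Ioc u v, if n.Prime then f n else 0 := by
  rw [primesIoc, Finset.sum_filter]

/-- The prime factorization of `N!`, on the logarithmic scale. -/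
theorem log_factorial_eq_sum (N : ℕ) :
    Real.log (N.factorial) =
      ∑ p ∈ primesIoc 0 N, (N.factorial.factorization p : ℝ) * Real.log p := by
  rw [Real.log_nat_eq_sum_factorization, Finsupp.sum]
  apply Finset.sum_subset
  · intro p hp
    rw [Nat.support_factorization, Nat.mem_primeFactors] at hp
    exact mem_primesIoc.2 ⟨⟨hp.1.pos, (hp.1.dvd_factorial).1 hp.2.1⟩, hp.1⟩
  · intro p _ hp
    rw [Finsupp.notMem_support_iff.1 hp]
    simp

theorem log_le_two_mul_sqrt {x : ℝ} (hx : 0 < x) : Real.log x ≤ 2 * √x := by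
  have h := Real.log_le_sub_one_of_pos (Real.sqrt_pos.2 hx)
  have h2 : Real.log (√x) = Real.log x / 2 := Real.log_sqrt hx.le
  linarith [Real.sqrt_nonneg x]

/-- The difference between `∑ log p / (p - 1)` and `∑ log p / p` stays bounded. -/
theorem exists_sum_log_div_mul_pred_le :
    ∃ B : ℝ, 0 ≤ B ∧ ∀ N : ℕ,
      ∑ p ∈ primesIoc 0 N, Real.log p * (1 / ((p : ℝ) - 1) - 1 / p) ≤ B := by
  have hs : Summable fun n : ℕ => 4 * (1 / (n : ℝ) ^ (3 / 2 : ℝ)) :=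
    (Real.summable_one_div_nat_rpow.2 (by norm_num)).mul_left 4
  refine ⟨∑' n : ℕ, 4 * (1 / (n : ℝ) ^ (3 / 2 : ℝ)), tsum_nonneg fun n => by positivity, ?_⟩
  intro N
  refine le_trans (Finset.sum_le_sum fun p hp => ?_)
    (hs.sum_le_tsum (primesIoc 0 N) fun n _ => by positivity)
  have hp2 : (2 : ℝ) ≤ p := by exact_mod_cast (mem_primesIoc.1 hp).2.two_le
  have hp0 : (0 : ℝ) < p := by linarith
  have h1 : 1 / ((p : ℝ) - 1) - 1 / p ≤ 2 / (p : ℝ) ^ 2 := by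
    rw [div_sub_div _ _ (by linarith) (by linarith), div_le_div_iff₀ (by nlinarith) (by positivity)]
    nlinarith
  have h2 : (p : ℝ) ^ (3 / 2 : ℝ) = p * √p := by
    rw [Real.sqrt_eq_rpow, ← Real.rpow_one_add' hp0.le (by norm_num)]; norm_num
  have hl : 0 ≤ Real.log p := Real.log_nonneg (by linarith)
  calc Real.log p * (1 / ((p : ℝ) - 1) - 1 / p) ≤ (2 * √p) * (2 / (p : ℝ) ^ 2) := by
        apply mul_le_mul (log_le_two_mul_sqrt hp0) h1 _ (by positivity)
        rw [sub_nonneg]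
        exact one_div_le_one_div_of_le (by linarith) (by linarith)
    _ = 4 * (1 / (p : ℝ) ^ (3 / 2 : ℝ)) := by
        rw [h2]
        have : √(p : ℝ) ^ 2 = p := Real.sq_sqrt hp0.le
        have hs : 0 < √(p : ℝ) := Real.sqrt_pos.2 hp0
        field_simp
        nlinarith

/-- Mertens' first theorem. -/
theorem exists_abs_sum_log_div_sub_log_le :
    ∃ K : ℝ, 0 ≤ K ∧ ∀ N : ℕ, 1 ≤ N →
      |∑ p ∈ primesIoc 0 N, Real.log p / p - Real.log N| ≤ K := by
  obtain ⟨B, hB0, hB⟩ := exists_sum_log_div_mul_pred_le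
  refine ⟨B + Real.log 4 + 1, by have := Real.log_nonneg (show (1 : ℝ) ≤ 4 by norm_num); linarith,
    fun N hN => ?_⟩
  have hN0 : (0 : ℝ) < N := by exact_mod_cast hN
  have hl4 : 0 ≤ Real.log 4 := Real.log_nonneg (by norm_num)
  set A := ∑ p ∈ primesIoc 0 N, Real.log p / p with hA
  -- Legendre's formula gives `N / p - 1 ≤ v_p(N!) ≤ N / (p - 1)`.
  have hupper : Real.log N.factorial ≤ N * (A + B) := by
    calc Real.log N.factorial
        = ∑ p ∈ primesIoc 0 N, (N.factorial.factorization p : ℝ) * Real.log p :=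
          log_factorial_eq_sum N
      _ ≤ ∑ p ∈ primesIoc 0 N, (N : ℝ) * (Real.log p / p
            + Real.log p * (1 / ((p : ℝ) - 1) - 1 / p)) := by
          apply Finset.sum_le_sum
          intro p hp
          have hpp := (mem_primesIoc.1 hp).2
          have hp2 : (2 : ℝ) ≤ p := by exact_mod_cast hpp.two_le
          have h := Nat.factorization_factorial_le_div_pred hpp N
          have h' : (N.factorial.factorization p : ℝ) ≤ N / ((p : ℝ) - 1) := by
            calc (N.factorial.factorization p : ℝ) ≤ ((N / (p - 1) : ℕ) : ℝ) := by exact_mod_cast h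
              _ ≤ (N : ℝ) / ((p - 1 : ℕ) : ℝ) := Nat.cast_div_le
              _ = N / ((p : ℝ) - 1) := by rw [Nat.cast_sub hpp.one_le]; simp
          calc _ ≤ N / ((p : ℝ) - 1) * Real.log p :=
                mul_le_mul_of_nonneg_right h' (Real.log_nonneg (by linarith))
            _ = _ := by ring
      _ = N * (A + ∑ p ∈ primesIoc 0 N, Real.log p * (1 / ((p : ℝ) - 1) - 1 / p)) := by
          rw [← Finset.mul_sum, Finset.sum_add_distrib]
      _ ≤ N * (A + B) := by
          have := hB N
          gcongr
  have htheta : ∑ p ∈ primesIoc 0 N, Real.log p ≤ Real.log 4 * N := by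
    have h := Chebyshev.theta_le_log4_mul_x hN0.le
    rw [Chebyshev.theta_eq_sum_primesLE_log, Nat.primesLE_eq_filter_Ioc_zero] at h
    exact h
  have hlower : N * A - Real.log 4 * N ≤ Real.log N.factorial := by
    rw [log_factorial_eq_sum, hA, Finset.mul_sum]
    refine le_trans (sub_le_sub_left htheta _) ?_
    rw [← Finset.sum_sub_distrib]
    apply Finset.sum_le_sum
    intro p hp
    have hpp := (mem_primesIoc.1 hp).2
    have hp2 : (2 : ℝ) ≤ p := by exact_mod_cast hpp.two_le
    have h : N / p ≤ N.factorial.factorization p := by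
      rw [Nat.factorization_factorial hpp (Nat.lt_succ_self _)]
      have hle : p ≤ N := (mem_primesIoc.1 hp).1.2
      have hmem : 1 ∈ Finset.Ico 1 (Nat.log p N).succ := by
        simp only [Finset.mem_Ico, le_refl, true_and]
        exact Nat.succ_lt_succ (Nat.log_pos hpp.one_lt hle)
      have := Finset.single_le_sum (f := fun i => N / p ^ i) (fun _ _ => Nat.zero_le _) hmem
      simpa using this
    have h' : (N : ℝ) / p - 1 ≤ N.factorial.factorization p := by
      have h1 : (N : ℝ) / p < ((N / p : ℕ) : ℝ) + 1 := by
        rw [div_lt_iff₀ (by linarith)]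
        rw [mul_comm]
        exact_mod_cast Nat.lt_mul_div_succ N hpp.pos
      have h2 : ((N / p : ℕ) : ℝ) ≤ N.factorial.factorization p := by exact_mod_cast h
      linarith
    calc (N : ℝ) * (Real.log p / p) - Real.log p = (N / p - 1) * Real.log p := by ring
      _ ≤ _ := mul_le_mul_of_nonneg_right h' (Real.log_nonneg (by linarith))
  have hst : N * Real.log N - N ≤ Real.log N.factorial := by
    have h := Stirling.le_log_factorial_stirling (n := N) (by omega)
    have h1 : 0 ≤ Real.log N := Real.log_nonneg (by exact_mod_cast hN)
    have h2 : 0 ≤ Real.log (2 * Real.pi) := Real.log_nonneg (by linarith [Real.pi_gt_three])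
    linarith
  have hst' : Real.log N.factorial ≤ N * Real.log N := by
    rw [← Real.log_pow]
    apply Real.log_le_log (by exact_mod_cast N.factorial_pos)
    exact_mod_cast N.factorial_le_pow
  have e1 : N * (Real.log N - 1) ≤ N * (A + B) := by linarith
  have e2 : N * (A - Real.log 4) ≤ N * Real.log N := by linarith
  have e1' := le_of_mul_le_mul_left e1 hN0
  have e2' := le_of_mul_le_mul_left e2 hN0
  rw [abs_le]
  constructor <;> linarith

/-- Dirichlet's test in finite form: if the sums of `c` over `(u, m]` are bounded by `B`, then
summing `c` against nonnegative decreasing weights `w` costs at most the first weight. -/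
theorem abs_sum_mul_le_of_antitone {c w : ℕ → ℝ} {u v : ℕ} {B : ℝ} (huv : u ≤ v)
    (hB : ∀ m, u ≤ m → |∑ n ∈ Finset.Ioc u m, c n| ≤ B)
    (hw : ∀ n, u ≤ n → w (n + 1) ≤ w n) (hw0 : ∀ n, u ≤ n → 0 ≤ w n) :
    |∑ n ∈ Finset.Ioc u v, c n * w n| ≤ B * w u := by
  have key : |∑ n ∈ Finset.Ioc u v, c n * w n - (∑ n ∈ Finset.Ioc u v, c n) * w v|
      ≤ B * (w u - w v) := by
    induction v, huv using Nat.le_induction with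
    | base => simp
    | succ v huv ih =>
      rw [Finset.sum_Ioc_succ_top (by omega), Finset.sum_Ioc_succ_top (by omega)]
      have h1 : |(∑ n ∈ Finset.Ioc u v, c n) * (w v - w (v + 1))| ≤ B * (w v - w (v + 1)) := by
        rw [abs_mul, abs_of_nonneg (sub_nonneg.2 (hw v huv))]
        exact mul_le_mul_of_nonneg_right (hB v huv) (sub_nonneg.2 (hw v huv))
      rw [abs_le] at *
      constructor <;> nlinarith
  have h2 : |(∑ n ∈ Finset.Ioc u v, c n) * w v| ≤ B * w v := by
    rw [abs_mul, abs_of_nonneg (hw0 v huv)]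
    exact mul_le_mul_of_nonneg_right (hB v huv) (hw0 v huv)
  rw [abs_le] at *
  constructor <;> linarith

theorem loglog_succ_sub_bounds {n : ℕ} (hn : 2 ≤ n) :
    (Real.log (n + 1) - Real.log n) / Real.log (n + 1) ≤
        Real.log (Real.log (n + 1)) - Real.log (Real.log n) ∧
      Real.log (Real.log (n + 1)) - Real.log (Real.log n) ≤
        (Real.log (n + 1) - Real.log n) / Real.log (n + 1)
          + (1 / Real.log n - 1 / Real.log (n + 1)) := by
  have hn' : (2 : ℝ) ≤ n := by exact_mod_cast hn
  have h0 : 0 < Real.log n := Real.log_pos (by linarith)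
  have h1 : Real.log n ≤ Real.log (n + 1) := Real.log_le_log (by linarith) (by linarith)
  have h01 : 0 < Real.log (n + 1) := by linarith
  have hd : Real.log (n + 1) - Real.log n ≤ 1 := by
    rw [← Real.log_div (by linarith) (by linarith)]
    have := Real.log_le_sub_one_of_pos (x := ((n : ℝ) + 1) / n) (by positivity)
    have h2 : ((n : ℝ) + 1) / n ≤ 2 := by rw [div_le_iff₀ (by linarith)]; linarith
    linarith
  constructor
  · have h := Real.log_le_sub_one_of_pos (x := Real.log n / Real.log (n + 1)) (by positivity)
    rw [Real.log_div h0.ne' h01.ne'] at h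
    have : (Real.log (n + 1) - Real.log n) / Real.log (n + 1) =
      1 - Real.log n / Real.log (n + 1) := by field_simp
    linarith
  · have h := Real.log_le_sub_one_of_pos (x := Real.log (n + 1) / Real.log n) (by positivity)
    rw [Real.log_div h01.ne' h0.ne'] at h
    refine h.trans ?_
    have e : (Real.log (n + 1) - Real.log n) / Real.log (n + 1)
          + (1 / Real.log n - 1 / Real.log (n + 1)) - (Real.log (n + 1) / Real.log n - 1)
        = (Real.log (n + 1) - Real.log n) * (1 - (Real.log (n + 1) - Real.log n)) /
          (Real.log n * Real.log (n + 1)) := by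
      field_simp
      ring
    have : 0 ≤ (Real.log (n + 1) - Real.log n) * (1 - (Real.log (n + 1) - Real.log n)) /
          (Real.log n * Real.log (n + 1)) := by
      apply div_nonneg (mul_nonneg _ _) (by positivity) <;> linarith
    linarith

/-- Mertens' second theorem on an interval. -/
theorem exists_abs_recipSum_sub_le :
    ∃ K : ℝ, 0 ≤ K ∧ ∀ u v : ℕ, 2 ≤ u → u ≤ v →
      |recipSum u v - (Real.log (Real.log v) - Real.log (Real.log u))| ≤ K / Real.log u := by
  obtain ⟨K, hK0, hK⟩ := exists_abs_sum_log_div_sub_log_le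
  refine ⟨2 * K + 1, by linarith, fun u v hu huv => ?_⟩
  -- `c` compares the weight `log p / p` at primes with the increment of `log`.
  set c : ℕ → ℝ := fun n =>
    (if n.Prime then Real.log n / n else 0) - (Real.log n - Real.log (n - 1 : ℝ)) with hc
  set w : ℕ → ℝ := fun n => 1 / Real.log n with hw
  have hpos : ∀ n : ℕ, u ≤ n → 0 < Real.log n := fun n hn =>
    Real.log_pos (by have : 2 ≤ n := hu.trans hn
                     exact_mod_cast this)
  have htel : ∀ (g : ℕ → ℝ) (m : ℕ), u ≤ m →
      ∑ n ∈ Finset.Ioc u m, (g n - g (n - 1)) = g m - g u := by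
    intro g m hm
    induction m, hm using Nat.le_induction with
    | base => simp
    | succ m hm ih => rw [Finset.sum_Ioc_succ_top (by omega), ih]; simp
  have hcast : ∀ n ∈ Finset.Ioc u v, ((n - 1 : ℕ) : ℝ) = (n : ℝ) - 1 := by
    intro n hn
    rw [Nat.cast_sub (by have := Finset.mem_Ioc.1 hn; omega)]; simp
  have hsum : ∀ m, u ≤ m → |∑ n ∈ Finset.Ioc u m, c n| ≤ 2 * K := by
    intro m hm
    have h1 : ∑ n ∈ Finset.Ioc u m, c n =
        (∑ p ∈ primesIoc 0 m, Real.log p / p - Real.log m) -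
          (∑ p ∈ primesIoc 0 u, Real.log p / p - Real.log u) := by
      have h2 := htel (fun n => Real.log n) m hm
      have h3 : ∑ n ∈ Finset.Ioc u m, (Real.log n - Real.log (n - 1 : ℝ)) =
          Real.log m - Real.log u := by
        rw [← h2]
        refine Finset.sum_congr rfl fun n hn => ?_
        rw [Nat.cast_sub (by have := Finset.mem_Ioc.1 hn; omega)]; simp
      rw [hc, Finset.sum_sub_distrib, h3, sum_primesIoc_eq_sum_ite (fun n => Real.log n / n),
        sum_primesIoc_eq_sum_ite (fun n => Real.log n / n),
        ← Finset.sum_Ioc_consecutive _ (Nat.zero_le u) hm]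
      ring
    rw [h1]
    have a1 := hK m (by omega)
    have a2 := hK u (by omega)
    rw [abs_le] at *
    constructor <;> linarith
  have hA := abs_sum_mul_le_of_antitone (w := w) huv hsum
    (fun n hn => by
      rw [hw]
      exact one_div_le_one_div_of_le (hpos n hn)
        (Real.log_le_log (by have : 0 < n := by omega
                             exact_mod_cast this) (by push_cast; linarith)))
    (fun n hn => (one_div_pos.2 (hpos n hn)).le)
  -- The weighted increments of `log` telescope to `log log` up to `1 / log u`.
  have hB : ∀ n ∈ Finset.Ioc u v,
      (Real.log n - Real.log (n - 1 : ℝ)) * w n ≤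
          Real.log (Real.log n) - Real.log (Real.log ((n - 1 : ℕ) : ℝ)) ∧
        Real.log (Real.log n) - Real.log (Real.log ((n - 1 : ℕ) : ℝ)) ≤
          (Real.log n - Real.log (n - 1 : ℝ)) * w n
            + (-(w n) - (-(w (n - 1)))) := by
    intro n hn
    obtain ⟨m, rfl⟩ : ∃ m, n = m + 1 := ⟨n - 1, by have := Finset.mem_Ioc.1 hn; omega⟩
    have hm : 2 ≤ m := by have := Finset.mem_Ioc.1 hn; omega
    have := loglog_succ_sub_bounds hm
    simp only [hw, Nat.add_sub_cancel]
    push_cast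
    rw [add_sub_cancel_right, mul_one_div]
    constructor
    · exact this.1
    · linarith [this.2]
  have hB1 := Finset.sum_le_sum fun n hn => (hB n hn).1
  have hB2 := Finset.sum_le_sum fun n hn => (hB n hn).2
  rw [htel (fun n => Real.log (Real.log n)) v huv] at hB1 hB2
  rw [Finset.sum_add_distrib, htel (fun n => -(w n)) v huv] at hB2
  have hsplit : ∑ n ∈ Finset.Ioc u v, c n * w n =
      recipSum u v - ∑ n ∈ Finset.Ioc u v, (Real.log n - Real.log (n - 1 : ℝ)) * w n := by
    rw [recipSum, sum_primesIoc_eq_sum_ite (fun n => 1 / (n : ℝ)), ← Finset.sum_sub_distrib]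
    refine Finset.sum_congr rfl fun n hn => ?_
    have := (hpos n (Finset.mem_Ioc.1 hn).1.le).ne'
    simp only [hc, hw, sub_mul]
    congr 1
    split_ifs
    · field_simp
    · simp
  rw [hsplit] at hA
  have hwv : 0 ≤ w v := (one_div_pos.2 (hpos v huv)).le
  have e : (2 * K + 1) / Real.log u = 2 * K * w u + w u := by simp only [hw]; ring
  rw [e]
  rw [abs_le] at *
  constructor <;> linarith

theorem le_floor_exp_iff {n : ℕ} (hn : 1 ≤ n) (t : ℝ) :
    n ≤ ⌊Real.exp t⌋₊ ↔ Real.log n ≤ t := by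
  rw [Nat.le_floor_iff (Real.exp_pos t).le, Real.log_le_iff_le_exp (by exact_mod_cast hn)]

theorem floor_exp_lt_iff {n : ℕ} (hn : 1 ≤ n) (t : ℝ) :
    ⌊Real.exp t⌋₊ < n ↔ t < Real.log n := by
  rw [← not_le, le_floor_exp_iff hn, not_le]

/-- Mertens' second theorem on an interval whose upper end is given on the logarithmic scale. -/
theorem exists_abs_recipSum_floor_exp_sub_le :
    ∃ K : ℝ, 0 ≤ K ∧ ∀ (u : ℕ) (t : ℝ), 2 ≤ u → Real.log u ≤ t →
      |recipSum u ⌊Real.exp t⌋₊ - (Real.log t - Real.log (Real.log u))| ≤ K / Real.log u := by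
  obtain ⟨K, hK0, hK⟩ := exists_abs_recipSum_sub_le
  refine ⟨K + 1, by linarith, fun u t hu ht => ?_⟩
  set v := ⌊Real.exp t⌋₊ with hv
  have huv : u ≤ v := (le_floor_exp_iff (by omega) t).2 ht
  have hu0 : 0 < Real.log u := Real.log_pos (by exact_mod_cast hu)
  have hv1 : (1 : ℝ) ≤ v := by exact_mod_cast (by omega : 1 ≤ v)
  have huv' : Real.log u ≤ Real.log v :=
    Real.log_le_log (by exact_mod_cast (by omega : 0 < u)) (by exact_mod_cast huv)
  have hvt : Real.log v ≤ t := (le_floor_exp_iff (by omega) t).1 le_rfl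
  have ht2 : t ≤ Real.log v + 1 := by
    have h1 : Real.exp t ≤ 2 * v := by
      have := Nat.lt_floor_add_one (Real.exp t)
      linarith
    have h2 : t ≤ Real.log (2 * v) := by
      rw [Real.le_log_iff_exp_le (by linarith)]; exact h1
    rw [Real.log_mul (by norm_num) (by linarith)] at h2
    linarith [Real.log_two_lt_d9]
  have h1 : Real.log (Real.log v) ≤ Real.log t := Real.log_le_log (by linarith) hvt
  have h2 : Real.log t - Real.log (Real.log v) ≤ 1 / Real.log u := by
    rw [← Real.log_div (by linarith) (by linarith)]
    have h := Real.log_le_sub_one_of_pos (x := t / Real.log v)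
      (div_pos (by linarith) (by linarith))
    have h3 : t / Real.log v ≤ 1 + 1 / Real.log v := by
      rw [div_le_iff₀ (by linarith), add_mul, one_div_mul_cancel (by linarith)]
      linarith
    have h4 : 1 / Real.log v ≤ 1 / Real.log u := one_div_le_one_div_of_le hu0 huv'
    linarith
  have h5 := hK u v hu huv
  rw [add_div]
  rw [abs_le] at *
  constructor <;> linarith

theorem recipSum_nonneg (u v : ℕ) : 0 ≤ recipSum u v :=
  Finset.sum_nonneg fun _ _ => by positivity

theorem recipSum_add {u v w : ℕ} (h₁ : u ≤ v) (h₂ : v ≤ w) :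
    recipSum u w = recipSum u v + recipSum v w := by
  simp only [recipSum]
  rw [sum_primesIoc_eq_sum_ite (fun n => 1 / (n : ℝ)),
    sum_primesIoc_eq_sum_ite (fun n => 1 / (n : ℝ)),
    sum_primesIoc_eq_sum_ite (fun n => 1 / (n : ℝ)), Finset.sum_Ioc_consecutive _ h₁ h₂]

/-- Mertens' second theorem for the primes up to `exp t`. -/
theorem exists_abs_recipSum_zero_floor_exp_sub_le :
    ∃ K : ℝ, 0 ≤ K ∧ ∀ t : ℝ, 1 ≤ t → |recipSum 0 ⌊Real.exp t⌋₊ - Real.log t| ≤ K := by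
  obtain ⟨K, hK0, hK⟩ := exists_abs_recipSum_floor_exp_sub_le
  have hl2 : 0 < Real.log 2 := Real.log_pos (by norm_num)
  refine ⟨K / Real.log 2 + |Real.log (Real.log 2)| + recipSum 0 2,
    add_nonneg (add_nonneg (by positivity) (abs_nonneg _)) (recipSum_nonneg _ _), fun t ht => ?_⟩
  have hl2' := Real.log_two_lt_d9
  have h := hK 2 t le_rfl (by push_cast; linarith)
  have h2 : 2 ≤ ⌊Real.exp t⌋₊ := (le_floor_exp_iff (by norm_num) t).2 (by push_cast; linarith)
  rw [recipSum_add (Nat.zero_le 2) h2]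
  have h3 := recipSum_nonneg 0 2
  have h4 := abs_le.1 (le_refl |Real.log (Real.log 2)|)
  push_cast at h
  rw [abs_le] at h ⊢
  constructor <;> linarith

theorem abs_log_one_sub_add_le {x : ℝ} (h1 : x ≤ 1 / 2) :
    |Real.log (1 - x) + x| ≤ 2 * x ^ 2 := by
  have hu := Real.log_le_sub_one_of_pos (x := 1 - x) (by linarith)
  have hl := Real.one_sub_inv_le_log_of_pos (x := 1 - x) (by linarith)
  have e : 1 - (1 - x)⁻¹ = -x - x ^ 2 / (1 - x) := by
    have : (1 - x) ≠ 0 := by linarith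
    field_simp
    ring
  have : x ^ 2 / (1 - x) ≤ 2 * x ^ 2 := by
    rw [div_le_iff₀ (by linarith)]
    nlinarith [sq_nonneg x]
  rw [abs_le]
  constructor <;> nlinarith [sq_nonneg x]

theorem inv_prime_le_half {p : ℕ} (hp : p.Prime) : 1 / (p : ℝ) ≤ 1 / 2 :=
  one_div_le_one_div_of_le (by norm_num) (by exact_mod_cast hp.two_le)

/-- The product of `1 - 1 / p` over the primes `p` in `(u, v]`: the probability that a random
integer has no prime factor there. -/
noncomputable def sieveProd (u v : ℕ) : ℝ := ∏ p ∈ primesIoc u v, (1 - 1 / (p : ℝ))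

theorem sieveProd_pos (u v : ℕ) : 0 < sieveProd u v :=
  Finset.prod_pos fun p hp => by
    have := inv_prime_le_half (mem_primesIoc.1 hp).2
    linarith

theorem sieveProd_le_one (u v : ℕ) : sieveProd u v ≤ 1 :=
  Finset.prod_le_one (fun p hp => by
    have := inv_prime_le_half (mem_primesIoc.1 hp).2
    linarith) fun p _ => by
      have : 0 ≤ 1 / (p : ℝ) := by positivity
      linarith

theorem abs_log_sieveProd_add_recipSum_le {u v : ℕ} (hu : 1 ≤ u) :
    |Real.log (sieveProd u v) + recipSum u v| ≤ 2 / u := by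
  rw [sieveProd, recipSum, Real.log_prod, ← Finset.sum_add_distrib]
  · refine (Finset.abs_sum_le_sum_abs _ _).trans ?_
    calc _ ≤ ∑ p ∈ primesIoc u v, 2 * (1 / (p : ℝ)) ^ 2 :=
          Finset.sum_le_sum fun p hp =>
            abs_log_one_sub_add_le (inv_prime_le_half (mem_primesIoc.1 hp).2)
      _ ≤ ∑ n ∈ Finset.Ioc u (max u v), 2 * (1 / (n : ℝ)) ^ 2 := by
          refine Finset.sum_le_sum_of_subset_of_nonneg ?_ fun _ _ _ => by positivity
          intro p hp
          have := (mem_primesIoc.1 hp).1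
          exact Finset.mem_Ioc.2 ⟨this.1, this.2.trans (le_max_right _ _)⟩
      _ = 2 * ∑ n ∈ Finset.Ioc u (max u v), ((n : ℝ) ^ 2)⁻¹ := by
          rw [Finset.mul_sum]
          simp
      _ ≤ 2 * ((u : ℝ)⁻¹ - ((max u v : ℕ) : ℝ)⁻¹) := by
          have := sum_Ioc_inv_sq_le_sub (α := ℝ) (by omega : u ≠ 0) (le_max_left u v)
          linarith
      _ ≤ 2 / u := by
          have : 0 ≤ ((max u v : ℕ) : ℝ)⁻¹ := by positivity
          rw [div_eq_mul_inv]
          linarith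
  · intro p hp
    have := inv_prime_le_half (mem_primesIoc.1 hp).2
    linarith

/-- Mertens' third theorem on an interval: the product over `(p, p ^ T]` is close to `1 / T`. -/
theorem exists_abs_log_sieveProd_add_log_le :
    ∃ K : ℝ, 0 ≤ K ∧ ∀ (p : ℕ) (T : ℝ), 2 ≤ p → 1 ≤ T →
      |Real.log (sieveProd p ⌊Real.exp (T * Real.log p)⌋₊) + Real.log T| ≤ K / Real.log p := by
  obtain ⟨K, hK0, hK⟩ := exists_abs_recipSum_floor_exp_sub_le
  refine ⟨K + 2, by linarith, fun p T hp hT => ?_⟩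
  have hp0 : 0 < Real.log p := Real.log_pos (by exact_mod_cast hp)
  have h1 := hK p (T * Real.log p) hp (by nlinarith)
  have h2 := abs_log_sieveProd_add_recipSum_le (u := p) (v := ⌊Real.exp (T * Real.log p)⌋₊)
    (by omega)
  have h3 : 2 / (p : ℝ) ≤ 2 / Real.log p :=
    div_le_div_of_nonneg_left (by norm_num) hp0 (Real.log_le_self (by positivity))
  rw [Real.log_mul (by linarith) hp0.ne'] at h1
  rw [add_div]
  rw [abs_le] at *
  constructor <;> linarith

/-! ### The independent model and the renewal equation -/

/-- The probability of the outcome `S` when each `p ∈ U` is selected independently with probability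
`1 / p`. -/
noncomputable def modelWeight (U S : Finset ℕ) : ℝ :=
  (∏ p ∈ S, 1 / (p : ℝ)) * ∏ p ∈ U \ S, (1 - 1 / (p : ℝ))

open Classical in
/-- The probability that the random subset of `U` described by `modelWeight` satisfies `A`. -/
noncomputable def modelProb (U : Finset ℕ) (A : Finset ℕ → Prop) : ℝ :=
  ∑ S ∈ U.powerset, if A S then modelWeight U S else 0

theorem one_sub_inv_natCast_nonneg (p : ℕ) : 0 ≤ 1 - 1 / (p : ℝ) := by
  rcases Nat.eq_zero_or_pos p with rfl | hp
  · simp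
  · have h : (1 : ℝ) ≤ p := by exact_mod_cast hp
    rw [sub_nonneg]
    exact (div_le_one (by linarith)).2 h

theorem modelWeight_nonneg (U S : Finset ℕ) : 0 ≤ modelWeight U S :=
  mul_nonneg (Finset.prod_nonneg fun _ _ => by positivity)
    (Finset.prod_nonneg fun p _ => one_sub_inv_natCast_nonneg p)

theorem sum_modelWeight (U : Finset ℕ) : ∑ S ∈ U.powerset, modelWeight U S = 1 := by
  simp only [modelWeight]
  rw [← Finset.prod_add]
  exact Finset.prod_eq_one fun p _ => by ring

theorem modelProb_mono {U : Finset ℕ} {A B : Finset ℕ → Prop} (h : ∀ S ⊆ U, A S → B S) :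
    modelProb U A ≤ modelProb U B :=
  Finset.sum_le_sum fun S hS => by
    by_cases hA : A S
    · simp [hA, h S (Finset.mem_powerset.1 hS) hA]
    · rw [if_neg hA]
      split_ifs <;> simp [modelWeight_nonneg]

theorem modelProb_congr {U : Finset ℕ} {A B : Finset ℕ → Prop} (h : ∀ S ⊆ U, (A S ↔ B S)) :
    modelProb U A = modelProb U B :=
  le_antisymm (modelProb_mono fun S hS => (h S hS).1) (modelProb_mono fun S hS => (h S hS).2)

theorem modelProb_true (U : Finset ℕ) : modelProb U (fun _ => True) = 1 := by
  simp [modelProb, sum_modelWeight]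

theorem modelProb_add_not (U : Finset ℕ) (A : Finset ℕ → Prop) :
    modelProb U A + modelProb U (fun S => ¬ A S) = 1 := by
  rw [← sum_modelWeight U, modelProb, modelProb, ← Finset.sum_add_distrib]
  refine Finset.sum_congr rfl fun S _ => ?_
  by_cases hA : A S <;> simp [hA]

theorem modelProb_eq_and_add_and_not (U : Finset ℕ) (A B : Finset ℕ → Prop) :
    modelProb U A = modelProb U (fun S => A S ∧ B S) + modelProb U (fun S => A S ∧ ¬ B S) := by
  rw [modelProb, modelProb, modelProb, ← Finset.sum_add_distrib]
  refine Finset.sum_congr rfl fun S _ => ?_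
  by_cases hA : A S <;> by_cases hB : B S <;> simp [hA, hB]

theorem modelProb_or_le (U : Finset ℕ) (A B : Finset ℕ → Prop) :
    modelProb U (fun S => A S ∨ B S) ≤ modelProb U A + modelProb U B := by
  rw [modelProb, modelProb, modelProb, ← Finset.sum_add_distrib]
  refine Finset.sum_le_sum fun S _ => ?_
  have := modelWeight_nonneg U S
  by_cases hA : A S <;> by_cases hB : B S <;> simp [hA, hB, this]

theorem modelProb_exists_le (U I : Finset ℕ) (A : ℕ → Finset ℕ → Prop) :
    modelProb U (fun S => ∃ i ∈ I, A i S) ≤ ∑ i ∈ I, modelProb U (A i) := by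
  induction I using Finset.induction_on with
  | empty => simp [modelProb]
  | insert i I hi ih =>
    rw [Finset.sum_insert hi]
    refine le_trans ?_ (add_le_add_right ih _)
    refine le_trans (modelProb_mono fun S _ h => ?_) (modelProb_or_le U _ _)
    simpa using h

theorem modelWeight_eq_mul {U V S : Finset ℕ} (hV : V ⊆ U) :
    modelWeight U S = modelWeight V (S ∩ V) * modelWeight (U \ V) (S \ V) := by
  have h1 : ∏ p ∈ S, 1 / (p : ℝ) = (∏ p ∈ S ∩ V, 1 / (p : ℝ)) * ∏ p ∈ S \ V, 1 / (p : ℝ) :=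
    (Finset.prod_inter_mul_prod_sdiff S V _).symm
  have h2 : ∏ p ∈ U \ S, (1 - 1 / (p : ℝ)) =
      (∏ p ∈ V \ (S ∩ V), (1 - 1 / (p : ℝ))) *
        ∏ p ∈ (U \ V) \ (S \ V), (1 - 1 / (p : ℝ)) := by
    rw [← Finset.prod_inter_mul_prod_sdiff (U \ S) V]
    congr 1
    · refine Finset.prod_congr ?_ fun _ _ => rfl
      ext p
      have := @hV p
      simp only [Finset.mem_inter, Finset.mem_sdiff]
      tauto
    · refine Finset.prod_congr ?_ fun _ _ => rfl
      ext p
      simp only [Finset.mem_sdiff]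
      tauto
  simp only [modelWeight]
  rw [h1, h2]
  ring

/-- Independence: the outcome inside `V` is independent of everything outside `V`. -/
theorem modelProb_inter_eq_and {U V W : Finset ℕ} (hV : V ⊆ U) (hW : W ⊆ V)
    (B : Finset ℕ → Prop) :
    modelProb U (fun S => S ∩ V = W ∧ B (S \ V)) =
      modelWeight V W * modelProb U (fun S => B (S \ V)) := by
  classical
  have key : ∀ A : Finset ℕ → Prop,
      modelProb U (fun S => A (S ∩ V) ∧ B (S \ V)) =
        modelProb V A * modelProb (U \ V) B := by
    intro A
    simp only [modelProb]
    rw [Finset.sum_mul_sum, ← Finset.sum_product']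
    refine Finset.sum_nbij' (fun S => (S ∩ V, S \ V)) (fun X => X.1 ∪ X.2) ?_ ?_ ?_ ?_ ?_
    · intro S hS
      rw [Finset.mem_powerset] at hS
      simp only [Finset.mem_product, Finset.mem_powerset]
      exact ⟨Finset.inter_subset_right, Finset.sdiff_subset_sdiff hS le_rfl⟩
    · intro X hX
      simp only [Finset.mem_product, Finset.mem_powerset] at hX
      exact Finset.mem_powerset.2
        (Finset.union_subset (hX.1.trans hV) (hX.2.trans Finset.sdiff_subset))
    · intro S _
      simp only
      rw [Finset.union_comm, Finset.sdiff_union_inter]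
    · intro X hX
      simp only [Finset.mem_product, Finset.mem_powerset] at hX
      have h1 : ∀ p ∈ X.1, p ∈ V := fun p hp => hX.1 hp
      have h2 : ∀ p ∈ X.2, p ∈ U ∧ p ∉ V := fun p hp => Finset.mem_sdiff.1 (hX.2 hp)
      ext p <;> simp only [Finset.mem_inter, Finset.mem_union, Finset.mem_sdiff] <;>
        specialize h1 p <;> specialize h2 p <;> tauto
    · intro S _
      rw [modelWeight_eq_mul hV]
      by_cases hA : A (S ∩ V) <;> by_cases hB : B (S \ V) <;> simp [hA, hB]
  have h1 := key (fun S => S = W)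
  have h2 := key (fun _ => True)
  rw [modelProb_true, one_mul] at h2
  rw [h1, ← h2]
  simp only [true_and]
  congr 1
  exact (Finset.sum_eq_single_of_mem W (Finset.mem_powerset.2 hW)
    fun S _ hS => if_neg hS).trans (if_pos rfl)

/-- `p ∈ S` is followed in `S` by a gap: no `q ∈ S` has `p < q ≤ p ^ T`. The largest element of `S`
qualifies. -/
def GapStart (T : ℝ) (p : ℕ) (S : Finset ℕ) : Prop :=
  p ∈ S ∧ ∀ q ∈ S, p < q → T * Real.log p < Real.log q

/-- The integer part of `p ^ T`. -/
noncomputable def powFloor (T : ℝ) (p : ℕ) : ℕ := ⌊Real.exp (T * Real.log p)⌋₊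

/-- The probability that a random integer is divisible by the prime `p` but by no prime in
`(p, p ^ T]`. -/
noncomputable def gapWeight (T : ℝ) (p : ℕ) : ℝ := 1 / (p : ℝ) * sieveProd p (powFloor T p)

theorem gapWeight_nonneg (T : ℝ) (p : ℕ) : 0 ≤ gapWeight T p :=
  mul_nonneg (by positivity) (sieveProd_pos _ _).le

theorem gapWeight_le_one (T : ℝ) (p : ℕ) : gapWeight T p ≤ 1 := by
  have := one_sub_inv_natCast_nonneg p
  exact mul_le_one₀ (by linarith) (sieveProd_pos _ _).le (sieveProd_le_one _ _)

theorem le_powFloor {T : ℝ} (hT : 1 ≤ T) {p : ℕ} (hp : 1 ≤ p) : p ≤ powFloor T p := by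
  rw [powFloor, le_floor_exp_iff hp]
  have : 0 ≤ Real.log p := Real.log_nonneg (by exact_mod_cast hp)
  nlinarith

theorem modelProb_gapStart_and {T : ℝ} (hT : 1 ≤ T) {y p : ℕ} (hp : p.Prime)
    (hpy : powFloor T p ≤ y) (B : Finset ℕ → Prop) :
    modelProb (primesIoc 0 y)
        (fun S => GapStart T p S ∧ B (S \ primesIoc (p - 1) (powFloor T p))) =
      gapWeight T p *
        modelProb (primesIoc 0 y) (fun S => B (S \ primesIoc (p - 1) (powFloor T p))) := by
  have hpW := le_powFloor hT hp.one_le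
  have hp0 := hp.pos
  set V := primesIoc (p - 1) (powFloor T p) with hVdef
  have hV : V ⊆ primesIoc 0 y := by
    intro q hq
    rw [hVdef, mem_primesIoc] at hq
    exact mem_primesIoc.2 ⟨⟨hq.2.pos, hq.1.2.trans hpy⟩, hq.2⟩
  have hpV : p ∈ V := mem_primesIoc.2 ⟨⟨by omega, hpW⟩, hp⟩
  have hw : modelWeight V {p} = gapWeight T p := by
    rw [modelWeight, gapWeight, Finset.prod_singleton, sieveProd]
    congr 1
    refine Finset.prod_congr ?_ fun _ _ => rfl
    ext q
    simp only [hVdef, Finset.mem_sdiff, mem_primesIoc, Finset.mem_singleton]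
    constructor
    · rintro ⟨⟨⟨h1, h2⟩, h3⟩, h4⟩
      exact ⟨⟨by omega, h2⟩, h3⟩
    · rintro ⟨⟨h1, h2⟩, h3⟩
      exact ⟨⟨⟨by omega, h2⟩, h3⟩, by omega⟩
  rw [← hw, ← modelProb_inter_eq_and hV (Finset.singleton_subset_iff.2 hpV)]
  refine modelProb_congr fun S hS => and_congr_left fun _ => ?_
  constructor
  · rintro ⟨h1, h2⟩
    ext q
    simp only [Finset.mem_inter, Finset.mem_singleton]
    constructor
    · rintro ⟨hqS, hqV⟩
      rw [hVdef, mem_primesIoc] at hqV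
      by_contra hne
      have := h2 q hqS (by omega)
      rw [← floor_exp_lt_iff hqV.2.one_le] at this
      exact absurd hqV.1.2 (by rw [powFloor]; omega)
    · rintro rfl
      exact ⟨h1, hpV⟩
  · intro h
    have hpS : p ∈ S ∩ V := by rw [h]; simp
    refine ⟨(Finset.mem_inter.1 hpS).1, fun q hq hpq => ?_⟩
    have hqp := (mem_primesIoc.1 (hS hq)).2
    rw [← floor_exp_lt_iff hqp.one_le]
    by_contra hle
    have hqV : q ∈ S ∩ V := Finset.mem_inter.2
      ⟨hq, mem_primesIoc.2 ⟨⟨by omega, by rw [powFloor]; omega⟩, hqp⟩⟩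
    rw [h, Finset.mem_singleton] at hqV
    omega

/-- No element of `S` in `(u, z]` is followed by a gap. -/
def NoGapStart (T : ℝ) (u z : ℕ) (S : Finset ℕ) : Prop :=
  ∀ q ∈ S, u < q → q ≤ z → ¬ GapStart T q S

theorem modelProb_gapStart {T : ℝ} (hT : 1 ≤ T) {y p : ℕ} (hp : p.Prime)
    (hpy : powFloor T p ≤ y) : modelProb (primesIoc 0 y) (GapStart T p) = gapWeight T p := by
  have h := modelProb_gapStart_and hT hp hpy fun _ => True
  simpa [modelProb_true] using h

theorem modelProb_gapStart_and_noGapStart {T : ℝ} (hT : 1 ≤ T) {y z p : ℕ} (hp : p.Prime)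
    (hpy : powFloor T p ≤ y) :
    modelProb (primesIoc 0 y) (fun S => GapStart T p S ∧ NoGapStart T p z S) =
      gapWeight T p * modelProb (primesIoc 0 y) (NoGapStart T (powFloor T p) z) := by
  have hpW := le_powFloor hT hp.one_le
  set W := powFloor T p with hW
  -- Whether a gap starts beyond `W` depends only on the elements beyond `W`.
  have hrestr : ∀ S : Finset ℕ,
      NoGapStart T W z S ↔ NoGapStart T W z (S \ primesIoc (p - 1) W) := by
    intro S
    have hmem : ∀ q, W < q → (q ∈ S \ primesIoc (p - 1) W ↔ q ∈ S) := by
      intro q hq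
      simp only [Finset.mem_sdiff, mem_primesIoc]
      constructor
      · exact fun h => h.1
      · exact fun h => ⟨h, fun h' => by omega⟩
    have hstart : ∀ q, W < q → (GapStart T q (S \ primesIoc (p - 1) W) ↔ GapStart T q S) := by
      intro q hq
      simp only [GapStart, hmem q hq]
      refine and_congr_right fun _ => forall_congr' fun r => ?_
      by_cases hr : q < r
      · rw [hmem r (hq.trans hr)]
      · simp [hr]
    refine forall_congr' fun q => ?_
    by_cases hq : W < q
    · rw [hmem q hq, hstart q hq]
    · simp [hq]
  have h := modelProb_gapStart_and hT hp hpy (NoGapStart T W z)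
  rw [← hW] at h
  simp only [← hrestr] at h
  rw [← h]
  refine modelProb_congr fun S hS => and_congr_right fun hstart => ?_
  constructor
  · intro h q hq hWq hqz
    exact h q hq (by omega) hqz
  · intro h q hq hpq hqz
    have := hstart.2 q hq hpq
    rw [← floor_exp_lt_iff (mem_primesIoc.1 (hS hq)).2.one_le] at this
    exact h q hq this hqz

/-- The renewal equation, obtained by conditioning on `p` starting the last gap. -/
theorem modelProb_noGapStart_pred {T : ℝ} (hT : 1 ≤ T) {y z p : ℕ} (hp : p.Prime) (hpz : p ≤ z)
    (hpy : powFloor T p ≤ y) :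
    modelProb (primesIoc 0 y) (NoGapStart T (p - 1) z) =
      modelProb (primesIoc 0 y) (NoGapStart T p z) -
        gapWeight T p * modelProb (primesIoc 0 y) (NoGapStart T (powFloor T p) z) := by
  rw [← modelProb_gapStart_and_noGapStart hT hp hpy, eq_sub_iff_add_eq,
    modelProb_eq_and_add_and_not _ (NoGapStart T p z) (GapStart T p), add_comm]
  congr 1
  · exact modelProb_congr fun S _ => and_comm
  · refine modelProb_congr fun S _ => ?_
    have hp0 := hp.pos
    constructor
    · intro h
      refine ⟨fun q hq hpq hqz => h q hq (by omega) hqz, fun hg => ?_⟩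
      exact h p hg.1 (by omega) hpz hg
    · rintro ⟨h, hg⟩ q hq hpq hqz
      rcases eq_or_ne q p with rfl | hne
      · exact hg
      · exact h q hq (by omega) hqz

/-- Raising the lower bound for the starts of gaps adds at most the probability that a gap starts in
between. -/
theorem modelProb_noGapStart_le_add {T : ℝ} (hT : 1 ≤ T) {y z u w : ℕ}
    (hz : ∀ p, p.Prime → p ≤ z → powFloor T p ≤ y) :
    modelProb (primesIoc 0 y) (NoGapStart T w z) ≤
      modelProb (primesIoc 0 y) (NoGapStart T u z) +
        ∑ p ∈ primesIoc u (min w z), gapWeight T p := by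
  have hsum : ∑ p ∈ primesIoc u (min w z), gapWeight T p =
      ∑ p ∈ primesIoc u (min w z), modelProb (primesIoc 0 y) (GapStart T p) := by
    refine Finset.sum_congr rfl fun p hp => ?_
    obtain ⟨⟨_, h2⟩, h3⟩ := mem_primesIoc.1 hp
    exact (modelProb_gapStart hT h3 (hz p h3 (h2.trans (min_le_right _ _)))).symm
  rw [hsum]
  refine le_trans ?_ (add_le_add_right (modelProb_exists_le _ _ _) _)
  refine le_trans (modelProb_mono fun S hS h => ?_) (modelProb_or_le _ _ _)
  by_contra hcon
  push Not at hcon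
  obtain ⟨h1, h2⟩ := hcon
  refine h1 fun q hq huq hqz hg => ?_
  by_cases hqw : q ≤ w
  · exact h2 q (mem_primesIoc.2 ⟨⟨huq, le_min hqw hqz⟩, (mem_primesIoc.1 (hS hq)).2⟩) hg
  · exact h q hq (by omega) hqz hg

theorem noGapStart_mono {T : ℝ} {u w z : ℕ} (h : u ≤ w) {S : Finset ℕ}
    (hS : NoGapStart T u z S) : NoGapStart T w z S :=
  fun q hq hwq hqz => hS q hq (by omega) hqz

/-- Solving the renewal equation: up to an error governed by the probability `η` of a gap starting
in `(p, p ^ T]`, gap starts at distinct primes behave as if independent. -/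
theorem modelProb_noGapStart_bounds {T : ℝ} (hT : 1 ≤ T) {y z : ℕ} {η : ℝ}
    (hz : ∀ p, p.Prime → p ≤ z → powFloor T p ≤ y)
    (hη : ∀ p, p.Prime → p ≤ z → ∑ q ∈ primesIoc p (powFloor T p), gapWeight T q ≤ η) :
    ∏ p ∈ primesIoc 0 z, (1 - gapWeight T p) - η * ∑ p ∈ primesIoc 0 z, gapWeight T p ≤
        modelProb (primesIoc 0 y) (NoGapStart T 0 z) ∧
      modelProb (primesIoc 0 y) (NoGapStart T 0 z) ≤
        ∏ p ∈ primesIoc 0 z, (1 - gapWeight T p) := by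
  set H : ℕ → ℝ := fun u => modelProb (primesIoc 0 y) (NoGapStart T u z) with hH
  suffices h : ∀ k u, u + k = z →
      ∏ p ∈ primesIoc u z, (1 - gapWeight T p) - η * ∑ p ∈ primesIoc u z, gapWeight T p ≤ H u ∧
      H u ≤ ∏ p ∈ primesIoc u z, (1 - gapWeight T p) by
    exact h z 0 (by omega)
  intro k
  induction k with
  | zero =>
    intro u hu
    obtain rfl : u = z := by omega
    have h1 : H u = 1 := by
      rw [hH, ← modelProb_true (primesIoc 0 y)]
      exact modelProb_congr fun S _ => ⟨fun _ => trivial, fun _ q _ h1 h2 => by omega⟩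
    have h2 : primesIoc u u = ∅ := by simp [primesIoc]
    rw [h1, h2]
    simp
  | succ k ih =>
    intro u hu
    obtain ⟨ih1, ih2⟩ := ih (u + 1) (by omega)
    by_cases hp : (u + 1).Prime
    · have hins : primesIoc u z = insert (u + 1) (primesIoc (u + 1) z) := by
        ext q
        simp only [Finset.mem_insert, mem_primesIoc]
        constructor
        · rintro ⟨⟨h1, h2⟩, h3⟩
          by_cases hq : q = u + 1
          · exact Or.inl hq
          · exact Or.inr ⟨⟨by omega, h2⟩, h3⟩
        · rintro (rfl | ⟨⟨h1, h2⟩, h3⟩)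
          · exact ⟨⟨by omega, by omega⟩, hp⟩
          · exact ⟨⟨by omega, h2⟩, h3⟩
      have hnot : u + 1 ∉ primesIoc (u + 1) z := by simp [primesIoc]
      rw [hins, Finset.prod_insert hnot, Finset.sum_insert hnot]
      set a := gapWeight T (u + 1) with ha
      have ha0 : 0 ≤ a := gapWeight_nonneg _ _
      have ha1 : a ≤ 1 := gapWeight_le_one _ _
      have hren : H u = H (u + 1) - a * H (powFloor T (u + 1)) :=
        modelProb_noGapStart_pred hT hp (by omega) (hz _ hp (by omega))
      have hlo : H (u + 1) ≤ H (powFloor T (u + 1)) :=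
        modelProb_mono fun S _ h => noGapStart_mono (le_powFloor hT hp.one_le) h
      have hhi : H (powFloor T (u + 1)) ≤ H (u + 1) + η := by
        refine (modelProb_noGapStart_le_add hT hz).trans (add_le_add_right ?_ _)
        refine le_trans ?_ (hη (u + 1) hp (by omega))
        refine Finset.sum_le_sum_of_subset_of_nonneg ?_ fun _ _ _ => gapWeight_nonneg _ _
        intro q hq
        obtain ⟨⟨h1, h2⟩, h3⟩ := mem_primesIoc.1 hq
        exact mem_primesIoc.2 ⟨⟨h1, h2.trans (min_le_left _ _)⟩, h3⟩
      have hη0 : 0 ≤ η := by linarith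
      have hs0 : 0 ≤ ∑ p ∈ primesIoc (u + 1) z, gapWeight T p :=
        Finset.sum_nonneg fun _ _ => gapWeight_nonneg _ _
      rw [hren]
      constructor
      · have e1 : a * H (powFloor T (u + 1)) ≤ a * (H (u + 1) + η) :=
          mul_le_mul_of_nonneg_left hhi ha0
        have e2 := mul_le_mul_of_nonneg_left ih1 (sub_nonneg.2 ha1)
        have e3 : 0 ≤ a * (η * ∑ p ∈ primesIoc (u + 1) z, gapWeight T p) := by positivity
        nlinarith
      · have e1 := mul_le_mul_of_nonneg_left hlo ha0
        have e2 := mul_le_mul_of_nonneg_left ih2 (sub_nonneg.2 ha1)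
        nlinarith
    · have heq : primesIoc u z = primesIoc (u + 1) z := by
        ext q
        simp only [mem_primesIoc]
        constructor
        · rintro ⟨⟨h1, h2⟩, h3⟩
          have : q ≠ u + 1 := by rintro rfl; exact hp h3
          exact ⟨⟨by omega, h2⟩, h3⟩
        · rintro ⟨⟨h1, h2⟩, h3⟩
          exact ⟨⟨by omega, h2⟩, h3⟩
      have hHeq : H u = H (u + 1) := by
        refine modelProb_congr fun S hS => ⟨noGapStart_mono (by omega), fun h q hq huq hqz => ?_⟩
        have : q ≠ u + 1 := by rintro rfl; exact hp (mem_primesIoc.1 (hS hq)).2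
        exact h q hq (by omega) hqz
      rw [heq, hHeq]
      exact ⟨ih1, ih2⟩

/-! ### Asymptotics in the model -/

theorem exists_abs_mul_gapWeight_sub_one_le :
    ∃ C : ℝ, 0 ≤ C ∧ ∀ (p : ℕ) (T : ℝ), 2 ≤ p → 1 ≤ T →
      |T * (p * gapWeight T p) - 1| ≤ C / Real.log p := by
  obtain ⟨K, hK0, hK⟩ := exists_abs_log_sieveProd_add_log_le
  refine ⟨K * Real.exp (K / Real.log 2), by positivity, fun p T hp hT => ?_⟩
  have hl2 : 0 < Real.log 2 := Real.log_pos (by norm_num)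
  have hp0 : (2 : ℝ) ≤ p := by exact_mod_cast hp
  have hlp : Real.log 2 ≤ Real.log p := Real.log_le_log (by norm_num) hp0
  have h := hK p T hp hT
  change |Real.log (sieveProd p (powFloor T p)) + Real.log T| ≤ _ at h
  set θ := Real.log (sieveProd p (powFloor T p)) + Real.log T with hθ
  have e : T * (p * gapWeight T p) = Real.exp θ := by
    rw [hθ, Real.exp_add, Real.exp_log (sieveProd_pos _ _), Real.exp_log (by linarith), gapWeight]
    field_simp
  rw [e]
  have h1 : θ ≤ Real.exp θ - 1 := by linarith [Real.add_one_le_exp θ]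
  have h2 : Real.exp θ - 1 ≤ θ * Real.exp θ := by
    have h3 := Real.add_one_le_exp (-θ)
    have h4 : Real.exp (-θ) * Real.exp θ = 1 := by rw [← Real.exp_add]; simp
    nlinarith [Real.exp_pos θ]
  have h3 : |Real.exp θ - 1| ≤ |θ| * Real.exp |θ| := by
    have h4 : 1 ≤ Real.exp |θ| := Real.one_le_exp (abs_nonneg θ)
    have h5 : Real.exp θ ≤ Real.exp |θ| := Real.exp_le_exp.2 (le_abs_self θ)
    rw [abs_le]
    constructor
    · nlinarith [neg_abs_le θ, abs_nonneg θ]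
    · refine h2.trans ((mul_le_mul_of_nonneg_right (le_abs_self θ) (Real.exp_pos θ).le).trans ?_)
      exact mul_le_mul_of_nonneg_left h5 (abs_nonneg θ)
  have h6 : |θ| ≤ K / Real.log 2 := h.trans (div_le_div_of_nonneg_left hK0 hl2 hlp)
  calc _ ≤ |θ| * Real.exp |θ| := h3
    _ ≤ K / Real.log p * Real.exp (K / Real.log 2) :=
        mul_le_mul h (Real.exp_le_exp.2 h6) (Real.exp_pos _).le (by positivity)
    _ = _ := by ring

/-- A bound `O(1 / (p T))` for the probability that `p` starts a gap, valid down to small primes,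
where the asymptotic `1 / (p T)` fails. -/
theorem exists_gapWeight_le :
    ∃ C : ℝ, 0 ≤ C ∧ ∀ (p : ℕ) (T : ℝ), 2 ≤ p → 1 ≤ T → gapWeight T p ≤ C / T * (1 / p) := by
  obtain ⟨C, hC0, hC⟩ := exists_abs_mul_gapWeight_sub_one_le
  have hl2 : 0 < Real.log 2 := Real.log_pos (by norm_num)
  refine ⟨C / Real.log 2 + 1, by positivity, fun p T hp hT => ?_⟩
  have hp0 : (2 : ℝ) ≤ p := by exact_mod_cast hp
  have hlp : Real.log 2 ≤ Real.log p := Real.log_le_log (by norm_num) hp0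
  have h := (abs_le.1 (hC p T hp hT)).2
  have h2 : C / Real.log p ≤ C / Real.log 2 := div_le_div_of_nonneg_left hC0 hl2 hlp
  rw [div_mul_div_comm, mul_one, le_div_iff₀ (by positivity)]
  linarith

/-- The series `∑ 1 / (p log p)` over primes grows slower than `∑ 1 / p`. -/
theorem tendsto_sum_inv_mul_log_div_recipSum :
    Tendsto (fun z : ℕ => (∑ p ∈ primesIoc 0 z, 1 / ((p : ℝ) * Real.log p)) / recipSum 0 z)
      atTop (𝓝 0) := by
  set g : ℕ → ℝ := fun n => if n.Prime then 1 / (n : ℝ) else 0 with hg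
  set f : ℕ → ℝ := fun n => if n.Prime then 1 / ((n : ℝ) * Real.log n) else 0 with hf
  have hg0 : ∀ n, 0 ≤ g n := fun n => by simp only [hg]; split_ifs <;> positivity
  have hdiv : Tendsto (fun n => ∑ i ∈ Finset.range n, g i) atTop atTop := by
    rw [← not_summable_iff_tendsto_nat_atTop_of_nonneg hg0]
    have h := not_summable_one_div_on_primes
    have e : Set.indicator {p : ℕ | p.Prime} (fun n : ℕ => (1 : ℝ) / n) = g := by
      ext n
      simp [hg, Set.indicator_apply]
    rwa [e] at h
  have hfg : f =o[atTop] g := by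
    have hlog : Tendsto (fun n : ℕ => 1 / Real.log n) atTop (𝓝 0) := by
      simp only [one_div]
      exact (Real.tendsto_log_atTop.comp tendsto_natCast_atTop_atTop).inv_tendsto_atTop
    have h := (Asymptotics.isLittleO_one_iff ℝ).2 hlog
    have h2 := h.mul_isBigO (Asymptotics.isBigO_refl g atTop)
    refine (h2.congr ?_ ?_)
    · intro n
      simp only [hf, hg]
      split_ifs
      · ring
      · simp
    · intro n; simp
  have h := (hfg.sum_range hg0 hdiv).tendsto_div_nhds_zero
  refine (h.comp (tendsto_add_atTop_nat 1)).congr fun z => ?_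
  have e : ∀ k : ℕ → ℝ, (∑ i ∈ Finset.range (z + 1), if i.Prime then k i else 0) =
      ∑ p ∈ primesIoc 0 z, k p := by
    intro k
    rw [← Finset.sum_filter]
    refine Finset.sum_congr ?_ fun _ _ => rfl
    ext p
    simp only [Finset.mem_filter, Finset.mem_range, mem_primesIoc]
    exact ⟨fun h => ⟨⟨h.2.pos, by omega⟩, h.2⟩, fun h => ⟨by omega, h.2⟩⟩
  simp only [Function.comp, recipSum, hf, hg]
  rw [e fun i => 1 / ((i : ℝ) * Real.log i), e fun i => 1 / (i : ℝ)]

/-- If `T / log s → 1 / κ`, the expected number of primes up to `exp s` that start a gap tends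
to `κ`. -/
theorem tendsto_sum_gapWeight {s T : ℕ → ℝ} {κ : ℝ} (hs : Tendsto s atTop atTop)
    (hT : Tendsto T atTop atTop)
    (hκ : Tendsto (fun N => Real.log (s N) / T N) atTop (𝓝 κ)) :
    Tendsto (fun N => ∑ p ∈ primesIoc 0 ⌊Real.exp (s N)⌋₊, gapWeight (T N) p) atTop (𝓝 κ) := by
  obtain ⟨K, hK0, hK⟩ := exists_abs_recipSum_zero_floor_exp_sub_le
  obtain ⟨C, hC0, hC⟩ := exists_abs_mul_gapWeight_sub_one_le
  set z : ℕ → ℕ := fun N => ⌊Real.exp (s N)⌋₊ with hz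
  have hzt : Tendsto z atTop atTop := tendsto_nat_floor_atTop.comp (Real.tendsto_exp_atTop.comp hs)
  have hTinv : Tendsto (fun N => (T N)⁻¹) atTop (𝓝 0) := hT.inv_tendsto_atTop
  have hR : Tendsto (fun N => recipSum 0 (z N) / T N) atTop (𝓝 κ) := by
    have h0 : Tendsto (fun N => (recipSum 0 (z N) - Real.log (s N)) / T N) atTop (𝓝 0) := by
      refine squeeze_zero_norm' (a := fun N => K * (T N)⁻¹) ?_ (by simpa using hTinv.const_mul K)
      filter_upwards [hs.eventually_ge_atTop 1, hT.eventually_ge_atTop 1] with N h1 h2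
      rw [Real.norm_eq_abs, abs_div, abs_of_pos (show 0 < T N by linarith), div_eq_mul_inv]
      exact mul_le_mul_of_nonneg_right (hK _ h1) (inv_nonneg.2 (by linarith))
    have := h0.add hκ
    rw [zero_add] at this
    exact this.congr fun N => by ring
  have hD := (tendsto_sum_inv_mul_log_div_recipSum.comp hzt).mul hR
  rw [zero_mul] at hD
  have hdiff : Tendsto (fun N => ∑ p ∈ primesIoc 0 (z N), gapWeight (T N) p
      - recipSum 0 (z N) / T N) atTop (𝓝 0) := by
    have hD' := hD.const_mul C
    rw [mul_zero] at hD'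
    refine squeeze_zero_norm' ?_ hD'
    filter_upwards [hT.eventually_ge_atTop 1, hzt.eventually_ge_atTop 2] with N hT1 hz2
    have hTpos : 0 < T N := by linarith
    have hRpos : recipSum 0 (z N) ≠ 0 := by
      have hmem : 2 ∈ primesIoc 0 (z N) := mem_primesIoc.2 ⟨⟨by norm_num, hz2⟩, Nat.prime_two⟩
      have := Finset.single_le_sum (f := fun p : ℕ => 1 / (p : ℝ)) (fun _ _ => by positivity) hmem
      have h2 : (1 : ℝ) / 2 ≤ recipSum 0 (z N) := by simpa [recipSum] using this
      linarith
    have e : (∑ p ∈ primesIoc 0 (z N), gapWeight (T N) p) - recipSum 0 (z N) / T N =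
        ∑ p ∈ primesIoc 0 (z N),
          (1 / T N * (1 / (p : ℝ))) * (T N * (p * gapWeight (T N) p) - 1) := by
      rw [recipSum, Finset.sum_div, ← Finset.sum_sub_distrib]
      refine Finset.sum_congr rfl fun p hp => ?_
      have : (p : ℝ) ≠ 0 := by exact_mod_cast (mem_primesIoc.1 hp).2.ne_zero
      field_simp
    rw [e, Real.norm_eq_abs]
    refine (Finset.abs_sum_le_sum_abs _ _).trans ?_
    have e2 : C * ((((fun z : ℕ => (∑ p ∈ primesIoc 0 z, 1 / ((p : ℝ) * Real.log p)) /
        recipSum 0 z) ∘ z) N) * (recipSum 0 (z N) / T N)) =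
        ∑ p ∈ primesIoc 0 (z N), (1 / T N * (1 / (p : ℝ))) * (C / Real.log p) := by
      simp only [Function.comp]
      rw [div_mul_div_cancel₀ hRpos, Finset.sum_div, Finset.mul_sum]
      refine Finset.sum_congr rfl fun p hp => ?_
      ring
    refine le_of_le_of_eq (Finset.sum_le_sum fun p hp => ?_) e2.symm
    rw [abs_mul, abs_of_nonneg (by positivity)]
    exact mul_le_mul_of_nonneg_left (hC p _ (mem_primesIoc.1 hp).2.two_le hT1) (by positivity)
  have := hdiff.add hR
  rw [zero_add] at this
  exact this.congr fun N => by ring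

/-- In the independent model, the probability that no prime up to `exp s` starts a gap. -/
theorem tendsto_modelProb_noGapStart {s T : ℕ → ℝ} {y : ℕ → ℕ} {κ : ℝ}
    (hs : Tendsto s atTop atTop) (hT : Tendsto T atTop atTop)
    (hκ : Tendsto (fun N => Real.log (s N) / T N) atTop (𝓝 κ))
    (hy : ∀ᶠ N in atTop, ∀ p : ℕ, p.Prime → p ≤ ⌊Real.exp (s N)⌋₊ → powFloor (T N) p ≤ y N) :
    Tendsto (fun N => modelProb (primesIoc 0 (y N)) (NoGapStart (T N) 0 ⌊Real.exp (s N)⌋₊))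
      atTop (𝓝 (Real.exp (-κ))) := by
  obtain ⟨K, hK0, hK⟩ := exists_abs_recipSum_floor_exp_sub_le
  obtain ⟨C, hC0, hC⟩ := exists_gapWeight_le
  have hl2 : 0 < Real.log 2 := Real.log_pos (by norm_num)
  set G : ℕ → ℝ := fun N => ∑ p ∈ primesIoc 0 ⌊Real.exp (s N)⌋₊, gapWeight (T N) p with hGdef
  have hG : Tendsto G atTop (𝓝 κ) := tendsto_sum_gapWeight hs hT hκ
  have hTinv : Tendsto (fun N => (T N)⁻¹) atTop (𝓝 0) := hT.inv_tendsto_atTop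
  set η : ℕ → ℝ := fun N => C * (Real.log (T N) / T N) + C * (K / Real.log 2) * (T N)⁻¹ with hηdef
  have hη : Tendsto η atTop (𝓝 0) := by
    have h1 := (Real.isLittleO_log_id_atTop.tendsto_div_nhds_zero.comp hT).const_mul C
    have h2 := hTinv.const_mul (C * (K / Real.log 2))
    simpa [hηdef, Function.comp] using h1.add h2
  have hlow : Tendsto (fun N => Real.exp (-(G N) - 2 * (C * (T N)⁻¹ * G N)) - η N * G N) atTop
      (𝓝 (Real.exp (-κ))) := by
    have h1 : Tendsto (fun N => -(G N) - 2 * (C * (T N)⁻¹ * G N)) atTop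
        (𝓝 (-κ - 2 * (C * 0 * κ))) :=
      hG.neg.sub (((hTinv.const_mul C).mul hG).const_mul 2)
    have h2 := (Real.continuous_exp.tendsto _).comp h1
    have h3 := h2.sub (hη.mul hG)
    simpa [Function.comp] using h3
  have hup : Tendsto (fun N => Real.exp (-(G N))) atTop (𝓝 (Real.exp (-κ))) :=
    (Real.continuous_exp.tendsto _).comp hG.neg
  have hsmall : ∀ᶠ N in atTop, C * (T N)⁻¹ ≤ 1 / 2 := by
    have h := hTinv.const_mul C
    rw [mul_zero] at h
    exact (h.eventually (gt_mem_nhds (by norm_num : (0 : ℝ) < 1 / 2))).mono fun _ h => h.le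
  have hbounds : ∀ᶠ N in atTop,
      Real.exp (-(G N) - 2 * (C * (T N)⁻¹ * G N)) - η N * G N ≤
        modelProb (primesIoc 0 (y N)) (NoGapStart (T N) 0 ⌊Real.exp (s N)⌋₊) ∧
      modelProb (primesIoc 0 (y N)) (NoGapStart (T N) 0 ⌊Real.exp (s N)⌋₊) ≤
        Real.exp (-(G N)) := by
    filter_upwards [hy, hT.eventually_ge_atTop 1, hsmall] with N hyN hT1 hsm
    have hTpos : 0 < T N := by linarith
    set z := ⌊Real.exp (s N)⌋₊ with hz
    have hηN : ∀ p : ℕ, p.Prime → p ≤ z →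
        ∑ q ∈ primesIoc p (powFloor (T N) p), gapWeight (T N) q ≤ η N := by
      intro p hp _
      have hlp : Real.log 2 ≤ Real.log p :=
        Real.log_le_log (by norm_num) (by exact_mod_cast hp.two_le)
      have h1 := (abs_le.1 (hK p (T N * Real.log p) hp.two_le (by nlinarith))).2
      rw [Real.log_mul hTpos.ne' (by linarith)] at h1
      have h2 : K / Real.log p ≤ K / Real.log 2 := div_le_div_of_nonneg_left hK0 hl2 hlp
      calc ∑ q ∈ primesIoc p (powFloor (T N) p), gapWeight (T N) q
          ≤ ∑ q ∈ primesIoc p (powFloor (T N) p), C / T N * (1 / (q : ℝ)) :=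
            Finset.sum_le_sum fun q hq => hC q _ (mem_primesIoc.1 hq).2.two_le hT1
        _ = C / T N * recipSum p ⌊Real.exp (T N * Real.log p)⌋₊ := by
            rw [← Finset.mul_sum, recipSum, powFloor]
        _ ≤ C / T N * (Real.log (T N) + K / Real.log 2) :=
            mul_le_mul_of_nonneg_left (by linarith) (by positivity)
        _ = η N := by simp only [hηdef]; ring
    obtain ⟨hb1, hb2⟩ := modelProb_noGapStart_bounds hT1 hyN hηN
    have ha : ∀ p ∈ primesIoc 0 z, gapWeight (T N) p ≤ C * (T N)⁻¹ := by
      intro p hp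
      have hpp := (mem_primesIoc.1 hp).2
      refine (hC p _ hpp.two_le hT1).trans ?_
      rw [div_eq_mul_inv]
      refine mul_le_of_le_one_right (by positivity) ?_
      have := inv_prime_le_half hpp
      linarith
    constructor
    · refine le_trans (sub_le_sub_right ?_ _) hb1
      have h1 : -(G N) - 2 * (C * (T N)⁻¹ * G N) ≤
          ∑ p ∈ primesIoc 0 z, (-gapWeight (T N) p - 2 * gapWeight (T N) p ^ 2) := by
        have h2 : ∑ p ∈ primesIoc 0 z, gapWeight (T N) p ^ 2 ≤ C * (T N)⁻¹ * G N := by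
          rw [hGdef, Finset.mul_sum]
          refine Finset.sum_le_sum fun p hp => ?_
          rw [sq]
          exact mul_le_mul_of_nonneg_right (ha p hp) (gapWeight_nonneg _ _)
        rw [Finset.sum_sub_distrib, Finset.sum_neg_distrib, ← Finset.mul_sum]
        linarith
      refine (Real.exp_le_exp.2 h1).trans ?_
      rw [Real.exp_sum]
      refine Finset.prod_le_prod (fun _ _ => (Real.exp_pos _).le) fun p hp => ?_
      have h2 := ha p hp
      have h3 := (abs_le.1 (abs_log_one_sub_add_le (h2.trans hsm))).1
      rw [← Real.le_log_iff_exp_le (by linarith)]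
      linarith
    · refine hb2.trans ?_
      rw [hGdef, ← Finset.sum_neg_distrib, Real.exp_sum]
      refine Finset.prod_le_prod (fun p _ => ?_) fun p _ => Real.one_sub_le_exp_neg _
      have := gapWeight_le_one (T N) p
      linarith
  exact tendsto_of_tendsto_of_tendsto_of_le_of_le' hlow hup
    (hbounds.mono fun _ h => h.1) (hbounds.mono fun _ h => h.2)

/-! ### Brun's pure sieve and the comparison with the model -/

open Classical in
/-- The proportion of the integers in `[1, N]` that satisfy `P`. -/
noncomputable def natProb (N : ℕ) (P : ℕ → Prop) : ℝ :=
  (∑ n ∈ Finset.Ioc 0 N, if P n then (1 : ℝ) else 0) / N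

theorem natProb_eq_ncard_div (N : ℕ) (P : ℕ → Prop) :
    natProb N P = (({n | P n} ∩ Set.Icc 1 N).ncard : ℝ) / N := by
  classical
  rw [natProb]
  congr 1
  rw [Finset.sum_ite, Finset.sum_const_zero, add_zero, Finset.sum_const, nsmul_eq_mul, mul_one,
    ← Set.ncard_coe_finset]
  congr 2
  ext n
  simp only [Finset.coe_filter, Finset.mem_Ioc, Set.mem_inter_iff, Set.mem_ofPred_eq, Set.mem_Icc]
  constructor
  · rintro ⟨⟨h1, h2⟩, h3⟩
    exact ⟨h3, h1, h2⟩
  · rintro ⟨h3, h1, h2⟩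
    exact ⟨⟨h1, h2⟩, h3⟩

theorem natProb_nonneg (N : ℕ) (P : ℕ → Prop) : 0 ≤ natProb N P :=
  div_nonneg (Finset.sum_nonneg fun _ _ => by split_ifs <;> norm_num) (Nat.cast_nonneg N)

theorem natProb_mono {N : ℕ} {P Q : ℕ → Prop} (h : ∀ n, 1 ≤ n → n ≤ N → P n → Q n) :
    natProb N P ≤ natProb N Q := by
  refine div_le_div_of_nonneg_right (Finset.sum_le_sum fun n hn => ?_) (Nat.cast_nonneg N)
  rw [Finset.mem_Ioc] at hn
  by_cases hP : P n
  · simp [hP, h n hn.1 hn.2 hP]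
  · rw [if_neg hP]
    split_ifs <;> norm_num

theorem natProb_add_not {N : ℕ} (hN : 1 ≤ N) (P : ℕ → Prop) :
    natProb N P + natProb N (fun n => ¬ P n) = 1 := by
  have hN0 : (N : ℝ) ≠ 0 := by exact_mod_cast (by omega : N ≠ 0)
  rw [natProb, natProb, ← add_div, ← Finset.sum_add_distrib, div_eq_one_iff_eq hN0]
  rw [Finset.sum_congr rfl (g := fun _ => (1 : ℝ)) fun n _ => by by_cases h : P n <;> simp [h]]
  simp

theorem natProb_or_le (N : ℕ) (P Q : ℕ → Prop) :
    natProb N (fun n => P n ∨ Q n) ≤ natProb N P + natProb N Q := by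
  rw [natProb, natProb, natProb, ← add_div, ← Finset.sum_add_distrib]
  refine div_le_div_of_nonneg_right (Finset.sum_le_sum fun n _ => ?_) (Nat.cast_nonneg N)
  by_cases hP : P n <;> by_cases hQ : Q n <;> simp [hP, hQ]

/-- A Bonferroni inequality: stopping inclusion-exclusion after an odd level bounds the indicator of
`F = ∅` from below. -/
theorem sum_powerset_neg_one_pow_card_lt_le (F : Finset ℕ) {k : ℕ} (hk : 1 ≤ k) :
    (∑ E ∈ F.powerset, if E.card < 2 * k then (-1 : ℝ) ^ E.card else 0) ≤
      if F = ∅ then 1 else 0 := by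
  rw [Finset.sum_powerset_apply_card (fun j => if j < 2 * k then (-1 : ℝ) ^ j else 0)]
  by_cases hF : F = ∅
  · subst hF
    simp [show 0 < k by omega]
  · rw [if_neg hF]
    obtain ⟨n, hn⟩ : ∃ n, F.card = n + 1 :=
      ⟨F.card - 1, by have := Finset.card_pos.2 (Finset.nonempty_iff_ne_empty.2 hF); omega⟩
    obtain ⟨m, hm⟩ : ∃ m, 2 * k = m + 1 := ⟨2 * k - 1, by omega⟩
    have hodd : Odd m := by
      rw [Nat.odd_iff]; omega
    have e : ∑ j ∈ Finset.range (F.card + 1),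
          F.card.choose j • (if j < 2 * k then (-1 : ℝ) ^ j else 0) =
        ∑ j ∈ Finset.range (m + 1), (-1 : ℝ) ^ j * (n + 1).choose j := by
      rw [hn, hm]
      calc _ = ∑ j ∈ Finset.range (max (n + 1) m + 1),
              (n + 1).choose j • (if j < m + 1 then (-1 : ℝ) ^ j else 0) := by
            refine Finset.sum_subset (fun j hj => ?_) fun j _ hj => ?_
            · simp only [Finset.mem_range] at *; omega
            · rw [Nat.choose_eq_zero_of_lt (by simpa using hj), zero_smul]
        _ = _ := by
            symm
            refine Finset.sum_subset_zero_on_sdiff (fun j hj => ?_) (fun j hj => ?_) fun j hj => ?_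
            · simp only [Finset.mem_range] at *; omega
            · simp only [Finset.mem_sdiff, Finset.mem_range] at hj
              rw [if_neg hj.2, smul_zero]
            · rw [if_pos (Finset.mem_range.1 hj), nsmul_eq_mul, mul_comm]
    rw [e]
    have h := Int.alternating_sum_range_choose_eq_choose (n := n) (m := m)
    have h' : (∑ j ∈ Finset.range (m + 1), (-1 : ℝ) ^ j * (n + 1).choose j) =
        (-1) ^ m * n.choose m := by exact_mod_cast h
    rw [h', hodd.neg_one_pow]
    have : (0 : ℝ) ≤ n.choose m := Nat.cast_nonneg _
    linarith

theorem subset_primeFactors_iff_prod_dvd {D : Finset ℕ} (hD : ∀ p ∈ D, p.Prime) {n : ℕ}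
    (hn : n ≠ 0) : D ⊆ n.primeFactors ↔ ∏ p ∈ D, p ∣ n := by
  constructor
  · intro h
    exact Finset.prod_primes_dvd n (fun p hp => (hD p hp).prime)
      fun p hp => Nat.dvd_of_mem_primeFactors (h hp)
  · intro h p hp
    exact Nat.mem_primeFactors.2 ⟨hD p hp, (Finset.dvd_prod_of_mem _ hp).trans h, hn⟩

theorem abs_sum_subset_primeFactors_sub_le {D : Finset ℕ} (hD : ∀ p ∈ D, p.Prime) (N : ℕ) :
    |(∑ n ∈ Finset.Ioc 0 N, if D ⊆ n.primeFactors then (1 : ℝ) else 0)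
      - N * ∏ p ∈ D, 1 / (p : ℝ)| ≤ 1 := by
  have hpos : 0 < ∏ p ∈ D, p := Finset.prod_pos fun p hp => (hD p hp).pos
  have h1 : (∑ n ∈ Finset.Ioc 0 N, if D ⊆ n.primeFactors then (1 : ℝ) else 0) =
      ((N / ∏ p ∈ D, p : ℕ) : ℝ) := by
    rw [← Nat.Ioc_filter_dvd_card_eq_div, Finset.card_filter, Nat.cast_sum]
    refine Finset.sum_congr rfl fun n hn => ?_
    have hn0 : n ≠ 0 := by have := Finset.mem_Ioc.1 hn; omega
    simp only [subset_primeFactors_iff_prod_dvd hD hn0]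
    split_ifs <;> simp
  have h2 : (N : ℝ) * ∏ p ∈ D, 1 / (p : ℝ) = (N : ℝ) / ((∏ p ∈ D, p : ℕ) : ℝ) := by
    rw [Finset.prod_div_distrib, Finset.prod_const_one, Nat.cast_prod]
    ring
  rw [h1, h2, ← Nat.floor_div_eq_div (K := ℝ)]
  have h3 := Nat.floor_le (show (0 : ℝ) ≤ (N : ℝ) / ((∏ p ∈ D, p : ℕ) : ℝ) by positivity)
  have h4 := Nat.lt_floor_add_one ((N : ℝ) / ((∏ p ∈ D, p : ℕ) : ℝ))
  rw [abs_le]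
  constructor <;> linarith

/-- The sum of `1 / d` over squarefree `d` composed of at least `m` primes of `U`. -/
noncomputable def recipTail (U : Finset ℕ) (m : ℕ) : ℝ :=
  ∑ E ∈ U.powerset, if m ≤ E.card then ∏ p ∈ E, 1 / (p : ℝ) else 0

/-- The number of subsets of `U` with fewer than `m` elements. -/
noncomputable def smallSubsets (U : Finset ℕ) (m : ℕ) : ℝ :=
  ∑ E ∈ U.powerset, if E.card < m then (1 : ℝ) else 0

theorem prod_one_div_nonneg (E : Finset ℕ) : 0 ≤ ∏ p ∈ E, 1 / (p : ℝ) :=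
  Finset.prod_nonneg fun _ _ => by positivity

/-- Brun's pure sieve, as a lower bound for the number of `n ≤ N` whose prime factors in `U` are
exactly those in `S`. -/
theorem le_sum_primeFactors_inter_eq {U S : Finset ℕ} (hU : ∀ p ∈ U, p.Prime) (hS : S ⊆ U) (N : ℕ)
    {k : ℕ} (hk : 1 ≤ k) :
    N * modelWeight U S - N * (∏ p ∈ S, 1 / (p : ℝ)) * recipTail U (2 * k)
        - smallSubsets U (2 * k) ≤
      ∑ n ∈ Finset.Ioc 0 N, if n.primeFactors ∩ U = S then (1 : ℝ) else 0 := by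
  set W := U \ S with hW
  have hWU : W ⊆ U := Finset.sdiff_subset
  have hpt : ∀ n ∈ Finset.Ioc 0 N,
      (∑ E ∈ W.powerset, if E.card < 2 * k then
        (-1 : ℝ) ^ E.card * (if S ∪ E ⊆ n.primeFactors then 1 else 0) else 0) ≤
      if n.primeFactors ∩ U = S then (1 : ℝ) else 0 := by
    intro n _
    by_cases hSn : S ⊆ n.primeFactors
    · have e : (∑ E ∈ W.powerset, if E.card < 2 * k then
            (-1 : ℝ) ^ E.card * (if S ∪ E ⊆ n.primeFactors then 1 else 0) else 0) =
          ∑ E ∈ (W ∩ n.primeFactors).powerset,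
            if E.card < 2 * k then (-1 : ℝ) ^ E.card else 0 := by
        symm
        refine Finset.sum_subset_zero_on_sdiff
          (Finset.powerset_mono.2 Finset.inter_subset_left) (fun E hE => ?_) fun E hE => ?_
        · rw [Finset.mem_sdiff, Finset.mem_powerset, Finset.mem_powerset] at hE
          have : ¬ (S ∪ E ⊆ n.primeFactors) := fun h =>
            hE.2 (Finset.subset_inter hE.1 (Finset.union_subset_right h))
          simp [this]
        · rw [Finset.mem_powerset] at hE
          have : S ∪ E ⊆ n.primeFactors :=
            Finset.union_subset hSn (hE.trans Finset.inter_subset_right)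
          simp [this]
      rw [e]
      refine (sum_powerset_neg_one_pow_card_lt_le _ hk).trans ?_
      by_cases hWn : W ∩ n.primeFactors = ∅
      · have : n.primeFactors ∩ U = S := by
          apply Finset.Subset.antisymm
          · intro p hp
            rw [Finset.mem_inter] at hp
            by_contra hpS
            have : p ∈ W ∩ n.primeFactors :=
              Finset.mem_inter.2 ⟨Finset.mem_sdiff.2 ⟨hp.2, hpS⟩, hp.1⟩
            rw [hWn] at this
            simp at this
          · exact Finset.subset_inter hSn hS
        simp [hWn, this]
      · rw [if_neg hWn]
        split_ifs <;> norm_num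
    · have : ∀ E, ¬ (S ∪ E ⊆ n.primeFactors) := fun E h => hSn (Finset.union_subset_left h)
      simp only [this, if_false, mul_zero, ite_self, Finset.sum_const_zero]
      split_ifs <;> norm_num
  refine le_trans ?_ (Finset.sum_le_sum hpt)
  rw [Finset.sum_comm]
  have hE : ∀ E ∈ W.powerset,
      N * (∏ p ∈ S, 1 / (p : ℝ)) * ((-1 : ℝ) ^ E.card * ∏ p ∈ E, 1 / (p : ℝ))
        - N * (∏ p ∈ S, 1 / (p : ℝ)) * (if 2 * k ≤ E.card then ∏ p ∈ E, 1 / (p : ℝ) else 0)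
        - (if E.card < 2 * k then (1 : ℝ) else 0) ≤
      ∑ n ∈ Finset.Ioc 0 N, if E.card < 2 * k then
        (-1 : ℝ) ^ E.card * (if S ∪ E ⊆ n.primeFactors then 1 else 0) else 0 := by
    intro E hE
    rw [Finset.mem_powerset] at hE
    have hpE := prod_one_div_nonneg E
    have hpS := prod_one_div_nonneg S
    have hsgn : |(-1 : ℝ) ^ E.card| = 1 := by simp
    by_cases hc : E.card < 2 * k
    · simp only [if_pos hc, if_neg (not_le.2 hc), mul_zero, sub_zero]
      rw [← Finset.mul_sum]
      have hdisj : Disjoint S E :=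
        Finset.disjoint_left.2 fun p hpS hpE => (Finset.mem_sdiff.1 (hE hpE)).2 hpS
      have h := abs_sum_subset_primeFactors_sub_le (D := S ∪ E) (fun p hp =>
        hU p (Finset.union_subset hS (hE.trans hWU) hp)) N
      rw [Finset.prod_union hdisj] at h
      set X := ∑ n ∈ Finset.Ioc 0 N, if S ∪ E ⊆ n.primeFactors then (1 : ℝ) else 0 with hX
      have h2 : |(-1 : ℝ) ^ E.card *
          (X - N * ((∏ p ∈ S, 1 / (p : ℝ)) * ∏ p ∈ E, 1 / (p : ℝ)))| ≤ 1 := by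
        rw [abs_mul, hsgn, one_mul]; exact h
      have h3 := (abs_le.1 h2).1
      linarith
    · simp only [if_neg hc, if_pos (not_lt.1 hc), Finset.sum_const_zero, sub_zero]
      have h1 : (-1 : ℝ) ^ E.card * (∏ p ∈ E, 1 / (p : ℝ)) ≤ ∏ p ∈ E, 1 / (p : ℝ) :=
        mul_le_of_le_one_left hpE ((le_abs_self _).trans hsgn.le)
      have h2 : 0 ≤ (N : ℝ) * ∏ p ∈ S, 1 / (p : ℝ) := by positivity
      have := mul_le_mul_of_nonneg_left h1 h2
      linarith
  refine le_trans ?_ (Finset.sum_le_sum hE)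
  rw [Finset.sum_sub_distrib, Finset.sum_sub_distrib, ← Finset.mul_sum, ← Finset.mul_sum]
  have hsub : W.powerset ⊆ U.powerset := Finset.powerset_mono.2 hWU
  have h1 : ∑ E ∈ W.powerset, (-1 : ℝ) ^ E.card * ∏ p ∈ E, 1 / (p : ℝ) =
      ∏ p ∈ W, (1 - 1 / (p : ℝ)) := by
    have h := Finset.prod_one_add (f := fun p : ℕ => -(1 / (p : ℝ))) W
    simp only [← sub_eq_add_neg] at h
    rw [h]
    refine Finset.sum_congr rfl fun E _ => ?_
    rw [Finset.prod_neg]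
  have h2 : ∑ E ∈ W.powerset, (if 2 * k ≤ E.card then ∏ p ∈ E, 1 / (p : ℝ) else 0) ≤
      recipTail U (2 * k) :=
    Finset.sum_le_sum_of_subset_of_nonneg hsub fun E _ _ => by
      split_ifs
      · exact prod_one_div_nonneg E
      · exact le_rfl
  have h3 : ∑ E ∈ W.powerset, (if E.card < 2 * k then (1 : ℝ) else 0) ≤
      smallSubsets U (2 * k) :=
    Finset.sum_le_sum_of_subset_of_nonneg hsub fun E _ _ => by split_ifs <;> norm_num
  have h4 : 0 ≤ (N : ℝ) * ∏ p ∈ S, 1 / (p : ℝ) :=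
    mul_nonneg (Nat.cast_nonneg N) (prod_one_div_nonneg S)
  have h5 := mul_le_mul_of_nonneg_left h2 h4
  rw [h1, modelWeight]
  linarith

/-- The error in comparing the integers up to `N` with the independent model. -/
noncomputable def modelError (U : Finset ℕ) (k N : ℕ) : ℝ :=
  recipTail U (2 * k) + (∏ p ∈ U, (1 + 1 / (p : ℝ))) * recipTail U (2 * k)
    + smallSubsets U (2 * k) ^ 2 / N

/-- Summing the sieve bound over the outcomes with fewer than `2 k` primes; the remaining outcomes
are rare in the model. -/
theorem modelProb_sub_modelError_le {U : Finset ℕ} (hU : ∀ p ∈ U, p.Prime) {k N : ℕ} (hk : 1 ≤ k)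
    (hN : 1 ≤ N) (A : Finset ℕ → Prop) :
    modelProb U A - modelError U k N ≤ natProb N fun n => A (n.primeFactors ∩ U) := by
  classical
  have hN0 : (0 : ℝ) < N := by exact_mod_cast hN
  set R := recipTail U (2 * k) with hR
  set C := smallSubsets U (2 * k) with hC
  have hR0 : 0 ≤ R := Finset.sum_nonneg fun E _ => by
    split_ifs
    · exact prod_one_div_nonneg E
    · exact le_rfl
  have hcount : ∑ S ∈ U.powerset, (if A S then
        ∑ n ∈ Finset.Ioc 0 N, (if n.primeFactors ∩ U = S then (1 : ℝ) else 0) else 0) =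
      ∑ n ∈ Finset.Ioc 0 N, if A (n.primeFactors ∩ U) then (1 : ℝ) else 0 := by
    have : ∀ S ∈ U.powerset, (if A S then
        ∑ n ∈ Finset.Ioc 0 N, (if n.primeFactors ∩ U = S then (1 : ℝ) else 0) else 0) =
        ∑ n ∈ Finset.Ioc 0 N,
          if n.primeFactors ∩ U = S then (if A S then (1 : ℝ) else 0) else 0 := by
      intro S _
      by_cases hA : A S <;> simp [hA]
    rw [Finset.sum_congr rfl this, Finset.sum_comm]
    refine Finset.sum_congr rfl fun n _ => ?_
    rw [Finset.sum_ite_eq, if_pos (Finset.mem_powerset.2 Finset.inter_subset_right)]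
  have hterm : ∀ S ∈ U.powerset,
      N * (if A S then modelWeight U S else 0)
        - N * (if 2 * k ≤ S.card then ∏ p ∈ S, 1 / (p : ℝ) else 0)
        - N * R * (∏ p ∈ S, 1 / (p : ℝ))
        - C * (if S.card < 2 * k then (1 : ℝ) else 0) ≤
      if A S then
        ∑ n ∈ Finset.Ioc 0 N, (if n.primeFactors ∩ U = S then (1 : ℝ) else 0) else 0 := by
    intro S hS
    rw [Finset.mem_powerset] at hS
    have hpS := prod_one_div_nonneg S
    have hC0 : 0 ≤ C := Finset.sum_nonneg fun E _ => by split_ifs <;> norm_num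
    have hRS : 0 ≤ N * R * (∏ p ∈ S, 1 / (p : ℝ)) := by positivity
    by_cases hA : A S
    · rw [if_pos hA, if_pos hA]
      by_cases hc : S.card < 2 * k
      · rw [if_pos hc, if_neg (not_le.2 hc)]
        have := le_sum_primeFactors_inter_eq hU hS N hk
        linarith
      · rw [if_neg hc, if_pos (not_lt.1 hc)]
        have h1 : modelWeight U S ≤ ∏ p ∈ S, 1 / (p : ℝ) :=
          mul_le_of_le_one_right hpS (Finset.prod_le_one
            (fun p _ => one_sub_inv_natCast_nonneg p) fun p _ => by
              have : 0 ≤ 1 / (p : ℝ) := by positivity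
              linarith)
        have h2 := mul_le_mul_of_nonneg_left h1 hN0.le
        have h3 : (0 : ℝ) ≤ ∑ n ∈ Finset.Ioc 0 N,
            (if n.primeFactors ∩ U = S then (1 : ℝ) else 0) :=
          Finset.sum_nonneg fun _ _ => by split_ifs <;> norm_num
        linarith
    · rw [if_neg hA, if_neg hA]
      have h1 : 0 ≤ N * (if 2 * k ≤ S.card then ∏ p ∈ S, 1 / (p : ℝ) else 0) := by
        split_ifs
        · positivity
        · simp
      have h2 : 0 ≤ C * (if S.card < 2 * k then (1 : ℝ) else 0) := by
        split_ifs
        · simpa using hC0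
        · simp
      linarith
  have hsum := Finset.sum_le_sum hterm
  rw [hcount, Finset.sum_sub_distrib, Finset.sum_sub_distrib, Finset.sum_sub_distrib,
    ← Finset.mul_sum, ← Finset.mul_sum, ← Finset.mul_sum, ← Finset.mul_sum,
    ← Finset.prod_one_add] at hsum
  rw [natProb, le_div_iff₀ hN0]
  refine le_of_eq_of_le ?_ hsum
  rw [modelError, ← hR, ← hC]
  change _ = N * modelProb U A - N * R - N * R * _ - C * C
  field_simp
  ring

/-- Comparison of the integers up to `N` with the independent model. A lower bound for every event
gives an upper bound by passing to the complement. -/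
theorem abs_natProb_sub_modelProb_le {U : Finset ℕ} (hU : ∀ p ∈ U, p.Prime) {k N : ℕ} (hk : 1 ≤ k)
    (hN : 1 ≤ N) (A : Finset ℕ → Prop) :
    |natProb N (fun n => A (n.primeFactors ∩ U)) - modelProb U A| ≤ modelError U k N := by
  have h1 := modelProb_sub_modelError_le hU hk hN A
  have h2 := modelProb_sub_modelError_le hU hk hN fun S => ¬ A S
  have h3 := modelProb_add_not U A
  have h4 := natProb_add_not hN fun n => A (n.primeFactors ∩ U)
  rw [abs_le]
  constructor <;> linarith

theorem sum_powerset_prod_le_exp (U : Finset ℕ) (f : ℕ → ℝ) (hf : ∀ p, 0 ≤ f p) :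
    ∑ E ∈ U.powerset, ∏ p ∈ E, f p ≤ Real.exp (∑ p ∈ U, f p) := by
  rw [← Finset.prod_one_add, Real.exp_sum]
  refine Finset.prod_le_prod (fun p _ => by have := hf p; linarith) fun p _ => ?_
  rw [add_comm]
  exact Real.add_one_le_exp _

/-- Rankin's trick, with the weight `e ^ 2` for each prime factor. -/
theorem recipTail_le (U : Finset ℕ) (k : ℕ) :
    recipTail U (2 * k) ≤ Real.exp (8 * ∑ p ∈ U, 1 / (p : ℝ) - 4 * k) := by
  have hexp : Real.exp 2 ≤ 8 := by
    have h := Real.exp_one_lt_d9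
    have h2 : Real.exp 2 = Real.exp 1 ^ 2 := by rw [← Real.exp_nat_mul]; norm_num
    rw [h2]
    nlinarith [Real.exp_pos 1]
  have h1 : recipTail U (2 * k) ≤
      ∑ E ∈ U.powerset, Real.exp (-(4 * k)) * ∏ p ∈ E, Real.exp 2 * (1 / (p : ℝ)) := by
    refine Finset.sum_le_sum fun E _ => ?_
    have hpE := prod_one_div_nonneg E
    rw [Finset.prod_mul_distrib, Finset.prod_const, ← Real.exp_nat_mul, ← mul_assoc, ← Real.exp_add]
    split_ifs with hc
    · refine le_mul_of_one_le_left hpE (Real.one_le_exp ?_)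
      have : ((2 * k : ℕ) : ℝ) ≤ E.card := by exact_mod_cast hc
      push_cast at this
      linarith
    · positivity
  refine h1.trans ?_
  rw [← Finset.mul_sum]
  have h2 := sum_powerset_prod_le_exp U (fun p => Real.exp 2 * (1 / (p : ℝ))) fun p => by positivity
  refine (mul_le_mul_of_nonneg_left h2 (Real.exp_pos _).le).trans ?_
  rw [← Real.exp_add, Real.exp_le_exp, ← Finset.mul_sum]
  have h3 : 0 ≤ ∑ p ∈ U, 1 / (p : ℝ) := Finset.sum_nonneg fun _ _ => by positivity
  nlinarith

theorem smallSubsets_le (y m : ℕ) (hy : 1 ≤ y) :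
    smallSubsets (primesIoc 0 y) m ≤ 3 * (y : ℝ) ^ m := by
  have hy1 : (1 : ℝ) ≤ y := by exact_mod_cast hy
  have h1 : smallSubsets (primesIoc 0 y) m ≤
      ∑ E ∈ (primesIoc 0 y).powerset, (y : ℝ) ^ m * ∏ p ∈ E, 1 / (y : ℝ) := by
    refine Finset.sum_le_sum fun E _ => ?_
    split_ifs with hc
    · rw [Finset.prod_const, one_div, inv_pow, ← div_eq_mul_inv,
        le_div_iff₀ (by positivity), one_mul]
      exact pow_le_pow_right₀ hy1 hc.le
    · positivity
  refine h1.trans ?_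
  rw [← Finset.mul_sum, mul_comm]
  refine mul_le_mul_of_nonneg_right ?_ (by positivity)
  refine (sum_powerset_prod_le_exp _ (fun _ => 1 / (y : ℝ)) fun _ => by positivity).trans ?_
  rw [Finset.sum_const, nsmul_eq_mul]
  have hcard : (primesIoc 0 y).card ≤ y := by
    refine (Finset.card_filter_le _ _).trans ?_
    simp
  have h2 : ((primesIoc 0 y).card : ℝ) * (1 / y) ≤ 1 := by
    rw [mul_one_div, div_le_one (by linarith)]
    exact_mod_cast hcard
  have h3 := Real.exp_le_exp.2 h2
  have := Real.exp_one_lt_d9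
  linarith

theorem modelError_le {y k N : ℕ} (hy : 1 ≤ y) :
    modelError (primesIoc 0 y) k N ≤
      2 * Real.exp (9 * recipSum 0 y - 4 * k) + 9 * (y : ℝ) ^ (4 * k) / N := by
  have hs := recipSum_nonneg 0 y
  have h1 : recipTail (primesIoc 0 y) (2 * k) ≤ Real.exp (8 * recipSum 0 y - 4 * k) :=
    recipTail_le _ k
  have h2 : ∏ p ∈ primesIoc 0 y, (1 + 1 / (p : ℝ)) ≤ Real.exp (recipSum 0 y) := by
    rw [Finset.prod_one_add]
    exact sum_powerset_prod_le_exp _ _ fun p => by positivity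
  have h3 := smallSubsets_le y (2 * k) hy
  have h4 : 0 ≤ smallSubsets (primesIoc 0 y) (2 * k) :=
    Finset.sum_nonneg fun E _ => by split_ifs <;> norm_num
  have h5 : 0 ≤ recipTail (primesIoc 0 y) (2 * k) := Finset.sum_nonneg fun E _ => by
    split_ifs
    · exact prod_one_div_nonneg E
    · exact le_rfl
  have h6 : Real.exp (8 * recipSum 0 y - 4 * k) ≤ Real.exp (9 * recipSum 0 y - 4 * k) :=
    Real.exp_le_exp.2 (by linarith)
  have h7 : (∏ p ∈ primesIoc 0 y, (1 + 1 / (p : ℝ))) * recipTail (primesIoc 0 y) (2 * k) ≤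
      Real.exp (9 * recipSum 0 y - 4 * k) := by
    refine (mul_le_mul h2 h1 h5 (Real.exp_pos _).le).trans_eq ?_
    rw [← Real.exp_add]
    ring_nf
  have h8 : smallSubsets (primesIoc 0 y) (2 * k) ^ 2 / N ≤ 9 * (y : ℝ) ^ (4 * k) / N := by
    refine div_le_div_of_nonneg_right ((pow_le_pow_left₀ h4 h3 2).trans_eq ?_) (Nat.cast_nonneg N)
    rw [mul_pow, ← pow_mul]
    norm_num
    ring_nf
  rw [modelError]
  linarith

/-! ### Turán's bound and gaps of integers -/

/-- Turán's variance bound: few integers avoid a set of primes with large reciprocal sum. -/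
theorem natProb_forall_not_dvd_mul_le {Q : Finset ℕ} {N : ℕ} (hN : 1 ≤ N)
    (hQ : ∀ p ∈ Q, p.Prime ∧ p ≤ N) :
    natProb N (fun n => ∀ p ∈ Q, ¬ p ∣ n) * ∑ p ∈ Q, 1 / (p : ℝ) ≤ 3 := by
  classical
  have hN0 : (0 : ℝ) < N := by exact_mod_cast hN
  set μ := ∑ p ∈ Q, 1 / (p : ℝ) with hμ
  have hμ0 : 0 ≤ μ := Finset.sum_nonneg fun _ _ => by positivity
  rcases hμ0.eq_or_lt with h0 | hμpos
  · rw [← h0]; norm_num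
  set ind : ℕ → ℕ → ℝ := fun p n => if p ∣ n then 1 else 0 with hind
  have hcount : ∀ d, ∑ n ∈ Finset.Ioc 0 N, ind d n = ((N / d : ℕ) : ℝ) := by
    intro d
    rw [← Nat.Ioc_filter_dvd_card_eq_div, Finset.card_filter, Nat.cast_sum]
    refine Finset.sum_congr rfl fun n _ => ?_
    simp only [hind]
    split_ifs <;> simp
  have hsq : ∑ n ∈ Finset.Ioc 0 N, (∑ p ∈ Q, ind p n) ^ 2 ≤ N * μ + N * μ ^ 2 := by
    have e1 : ∑ n ∈ Finset.Ioc 0 N, (∑ p ∈ Q, ind p n) ^ 2 =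
        ∑ p ∈ Q, ∑ q ∈ Q, ∑ n ∈ Finset.Ioc 0 N, ind p n * ind q n := by
      simp only [sq, Finset.sum_mul_sum]
      rw [Finset.sum_comm]
      exact Finset.sum_congr rfl fun p _ => Finset.sum_comm
    have e2 : N * μ + N * μ ^ 2 = ∑ p ∈ Q, ∑ q ∈ Q,
        ((if p = q then (N : ℝ) * (1 / p) else 0) + N * ((1 / (p : ℝ)) * (1 / q))) := by
      simp only [Finset.sum_add_distrib, ← Finset.mul_sum]
      rw [sq, hμ, Finset.sum_mul_sum]
      congr 1
      · rw [Finset.mul_sum]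
        refine Finset.sum_congr rfl fun p hp => ?_
        rw [Finset.sum_ite_eq, if_pos hp]
      · simp only [Finset.mul_sum]
    rw [e1, e2]
    refine Finset.sum_le_sum fun p hp => Finset.sum_le_sum fun q hq => ?_
    by_cases hpq : p = q
    · subst hpq
      rw [if_pos rfl]
      have e3 : ∀ n, ind p n * ind p n = ind p n := fun n => by
        simp only [hind]; split_ifs <;> simp
      simp only [e3]
      rw [hcount]
      have h1 : ((N / p : ℕ) : ℝ) ≤ N / p := Nat.cast_div_le
      have h2 : (0 : ℝ) ≤ N * ((1 / (p : ℝ)) * (1 / p)) := by positivity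
      have h3 : (N : ℝ) * (1 / p) = N / p := by ring
      linarith
    · rw [if_neg hpq, zero_add]
      have hcop : Nat.Coprime p q := (Nat.coprime_primes (hQ p hp).1 (hQ q hq).1).2 hpq
      have e3 : ∀ n, ind p n * ind q n = ind (p * q) n := fun n => by
        have hdvd : p * q ∣ n ↔ p ∣ n ∧ q ∣ n :=
          ⟨fun h => ⟨dvd_of_mul_right_dvd h, dvd_of_mul_left_dvd h⟩,
            fun h => hcop.mul_dvd_of_dvd_of_dvd h.1 h.2⟩
        simp only [hind, hdvd]
        by_cases h1 : p ∣ n <;> by_cases h2 : q ∣ n <;> simp [h1, h2]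
      simp only [e3]
      rw [hcount]
      have h1 : ((N / (p * q) : ℕ) : ℝ) ≤ N / ((p * q : ℕ) : ℝ) := Nat.cast_div_le
      refine h1.trans_eq ?_
      push_cast
      ring
  have hlin : N * μ - N ≤ ∑ n ∈ Finset.Ioc 0 N, ∑ p ∈ Q, ind p n := by
    rw [Finset.sum_comm]
    simp only [hcount]
    have hcard : (Q.card : ℝ) ≤ N := by
      have h : Q ⊆ Finset.Ioc 0 N := fun p hp =>
        Finset.mem_Ioc.2 ⟨(hQ p hp).1.pos, (hQ p hp).2⟩
      have := Finset.card_le_card h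
      rw [Nat.card_Ioc] at this
      exact_mod_cast this
    have h : ∑ p ∈ Q, ((N : ℝ) * (1 / p) - 1) ≤ ∑ p ∈ Q, ((N / p : ℕ) : ℝ) := by
      refine Finset.sum_le_sum fun p _ => ?_
      rw [← Nat.floor_div_eq_div (K := ℝ)]
      have := Nat.lt_floor_add_one ((N : ℝ) / p)
      have h3 : (N : ℝ) * (1 / p) = N / p := by ring
      linarith
    rw [Finset.sum_sub_distrib, ← Finset.mul_sum, Finset.sum_const, nsmul_eq_mul, mul_one] at h
    linarith
  have hvar : ∑ n ∈ Finset.Ioc 0 N, (∑ p ∈ Q, ind p n - μ) ^ 2 ≤ 3 * μ * N := by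
    have e : ∑ n ∈ Finset.Ioc 0 N, (∑ p ∈ Q, ind p n - μ) ^ 2 =
        ∑ n ∈ Finset.Ioc 0 N, (∑ p ∈ Q, ind p n) ^ 2
          - 2 * μ * ∑ n ∈ Finset.Ioc 0 N, ∑ p ∈ Q, ind p n + N * μ ^ 2 := by
      have : ∀ n, (∑ p ∈ Q, ind p n - μ) ^ 2 =
          (∑ p ∈ Q, ind p n) ^ 2 - 2 * μ * (∑ p ∈ Q, ind p n) + μ ^ 2 := fun n => by ring
      simp only [this, Finset.sum_add_distrib, Finset.sum_sub_distrib, ← Finset.mul_sum]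
      simp
    rw [e]
    nlinarith
  have hlow : (∑ n ∈ Finset.Ioc 0 N, if ∀ p ∈ Q, ¬ p ∣ n then (1 : ℝ) else 0) * μ ^ 2 ≤
      ∑ n ∈ Finset.Ioc 0 N, (∑ p ∈ Q, ind p n - μ) ^ 2 := by
    rw [Finset.sum_mul]
    refine Finset.sum_le_sum fun n _ => ?_
    split_ifs with h
    · have : ∑ p ∈ Q, ind p n = 0 := Finset.sum_eq_zero fun p hp => if_neg (h p hp)
      rw [this]
      exact le_of_eq (by ring)
    · rw [zero_mul]; positivity
  have hfin := hlow.trans hvar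
  have e : natProb N (fun n => ∀ p ∈ Q, ¬ p ∣ n) =
      (∑ n ∈ Finset.Ioc 0 N, if ∀ p ∈ Q, ¬ p ∣ n then (1 : ℝ) else 0) / N := by
    rw [natProb]
    congr 1
    exact Finset.sum_congr rfl fun n _ => by congr
  rw [e, div_mul_eq_mul_div, div_le_iff₀ hN0]
  refine le_of_mul_le_mul_right ?_ hμpos
  nlinarith

/-- The square root of `log log N`. -/
noncomputable def rootLogLog (N : ℕ) : ℝ := √(Real.log (Real.log N))

/-- A cutoff on the scale of `log p`, namely `log N / (log log N) ^ (k / 2)`. -/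
noncomputable def logCut (k N : ℕ) : ℝ := Real.log N / rootLogLog N ^ k

theorem tendsto_log_natCast : Tendsto (fun N : ℕ => Real.log N) atTop atTop :=
  Real.tendsto_log_atTop.comp tendsto_natCast_atTop_atTop

theorem tendsto_loglog_natCast : Tendsto (fun N : ℕ => Real.log (Real.log N)) atTop atTop :=
  Real.tendsto_log_atTop.comp tendsto_log_natCast

theorem tendsto_rootLogLog : Tendsto rootLogLog atTop atTop :=
  Real.tendsto_sqrt_atTop.comp tendsto_loglog_natCast

theorem eventually_rootLogLog_sq :
    ∀ᶠ N : ℕ in atTop, rootLogLog N ^ 2 = Real.log (Real.log N) := by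
  filter_upwards [tendsto_loglog_natCast.eventually_ge_atTop 0] with N h
  exact Real.sq_sqrt h

theorem eventually_exp_rootLogLog_sq :
    ∀ᶠ N : ℕ in atTop, Real.exp (rootLogLog N ^ 2) = Real.log N := by
  filter_upwards [eventually_rootLogLog_sq, tendsto_log_natCast.eventually_gt_atTop 0] with N h h2
  rw [h, Real.exp_log h2]

theorem tendsto_logCut (k : ℕ) : Tendsto (logCut k) atTop atTop := by
  refine tendsto_atTop_mono' _ ?_
    ((Real.tendsto_exp_div_pow_atTop k).comp tendsto_rootLogLog)
  filter_upwards [eventually_exp_rootLogLog_sq, tendsto_rootLogLog.eventually_ge_atTop 1]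
    with N h h1
  simp only [Function.comp, logCut]
  rw [← h]
  refine div_le_div_of_nonneg_right (Real.exp_le_exp.2 ?_) (by positivity)
  nlinarith

/-- Almost all integers have a prime factor in each of these short windows. -/
theorem tendsto_natProb_window_empty {k : ℕ} (hk : 1 ≤ k) :
    Tendsto (fun N => natProb N fun n =>
      ∀ p ∈ primesIoc ⌊Real.exp (logCut k N)⌋₊ ⌊Real.exp (√(rootLogLog N) * logCut k N)⌋₊,
        ¬ p ∣ n) atTop (𝓝 0) := by
  obtain ⟨K, hK0, hK⟩ := exists_abs_recipSum_floor_exp_sub_le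
  have hl2 : 0 < Real.log 2 := Real.log_pos (by norm_num)
  have hsqrt : Tendsto (fun N => √(rootLogLog N)) atTop atTop :=
    Real.tendsto_sqrt_atTop.comp tendsto_rootLogLog
  have hμ : Tendsto (fun N => Real.log (√(rootLogLog N)) - K / Real.log 2) atTop atTop :=
    tendsto_atTop_add_const_right _ _ (Real.tendsto_log_atTop.comp hsqrt)
  have h3 : Tendsto (fun N => 3 / (Real.log (√(rootLogLog N)) - K / Real.log 2)) atTop (𝓝 0) :=
    hμ.const_div_atTop 3
  refine squeeze_zero' (Eventually.of_forall fun N => natProb_nonneg _ _) ?_ h3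
  filter_upwards [hμ.eventually_gt_atTop 0, (tendsto_logCut k).eventually_ge_atTop 1,
    tendsto_rootLogLog.eventually_ge_atTop 1, eventually_ge_atTop 1] with N hpos hcut hM hN
  have hN0 : (0 : ℝ) < N := by exact_mod_cast hN
  have hsM : 1 ≤ √(rootLogLog N) := Real.one_le_sqrt.2 hM
  set u := ⌊Real.exp (logCut k N)⌋₊ with hu
  set v := ⌊Real.exp (√(rootLogLog N) * logCut k N)⌋₊ with hv
  have hlogN : √(rootLogLog N) * logCut k N ≤ Real.log N := by
    have hpow : rootLogLog N ≤ rootLogLog N ^ k := le_self_pow₀ hM (by omega)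
    have hsle : √(rootLogLog N) ≤ rootLogLog N := Real.sqrt_le_iff.2 ⟨by linarith, by nlinarith⟩
    have hlog : 0 ≤ Real.log N := Real.log_nonneg (by exact_mod_cast hN)
    rw [logCut, mul_div_assoc', div_le_iff₀ (by positivity), mul_comm]
    exact mul_le_mul_of_nonneg_left (hsle.trans hpow) hlog
  have hvN : v ≤ N := by
    rw [hv]
    refine Nat.floor_le_of_le ?_
    rw [← Real.le_log_iff_exp_le hN0]
    exact hlogN
  have hu2 : 2 ≤ u := (le_floor_exp_iff (by norm_num) _).2
    (by push_cast; linarith [Real.log_two_lt_d9])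
  have hulog : Real.log u ≤ logCut k N := (le_floor_exp_iff (by omega) _).1 le_rfl
  have hul2 : Real.log 2 ≤ Real.log u := Real.log_le_log (by norm_num) (by exact_mod_cast hu2)
  have h1 := (abs_le.1 (hK u (√(rootLogLog N) * logCut k N) hu2 (by nlinarith))).1
  have h2 : Real.log (Real.log u) ≤ Real.log (logCut k N) :=
    Real.log_le_log (by linarith) hulog
  have h4 : K / Real.log u ≤ K / Real.log 2 := div_le_div_of_nonneg_left hK0 hl2 hul2
  rw [Real.log_mul (by linarith) (by linarith)] at h1
  have hrec : Real.log (√(rootLogLog N)) - K / Real.log 2 ≤ recipSum u v := by linarith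
  have hT := natProb_forall_not_dvd_mul_le hN (Q := primesIoc u v) fun p hp =>
    ⟨(mem_primesIoc.1 hp).2, (mem_primesIoc.1 hp).1.2.trans hvN⟩
  rw [le_div_iff₀ hpos]
  refine le_trans (mul_le_mul_of_nonneg_left hrec (natProb_nonneg _ _)) hT

/-- The model applies up to `y = exp (logCut 3 N)`. Truncating at `2 k ≈ 8 log log N` primes makes
Rankin's bound beat `exp (9 ∑ 1 / p)`, while `y ^ (4 k)` stays below `√N`. -/
theorem tendsto_modelError :
    Tendsto (fun N : ℕ => modelError (primesIoc 0 ⌊Real.exp (logCut 3 N)⌋₊)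
      ⌈4 * Real.log (Real.log N)⌉₊ N) atTop (𝓝 0) := by
  obtain ⟨K, hK0, hK⟩ := exists_abs_recipSum_zero_floor_exp_sub_le
  have hlim : Tendsto (fun N : ℕ => 2 * Real.exp (9 * K - 7 * Real.log (Real.log N))
      + 9 * Real.exp (-(Real.log N / 2))) atTop (𝓝 0) := by
    have h1 : Tendsto (fun N : ℕ => 9 * K - 7 * Real.log (Real.log N)) atTop atBot :=
      tendsto_atBot_add_const_left _ _ (tendsto_neg_atTop_atBot.comp
        (tendsto_loglog_natCast.const_mul_atTop (by norm_num)))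
    have h2 : Tendsto (fun N : ℕ => -(Real.log N / 2)) atTop atBot :=
      tendsto_neg_atTop_atBot.comp (tendsto_log_natCast.atTop_div_const (by norm_num))
    have h3 := ((Real.tendsto_exp_atBot.comp h1).const_mul 2).add
      ((Real.tendsto_exp_atBot.comp h2).const_mul 9)
    simpa [Function.comp] using h3
  refine squeeze_zero' ?_ ?_ hlim
  · filter_upwards with N
    have h5 : 0 ≤ recipTail (primesIoc 0 ⌊Real.exp (logCut 3 N)⌋₊)
        (2 * ⌈4 * Real.log (Real.log N)⌉₊) := Finset.sum_nonneg fun E _ => by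
      split_ifs
      · exact prod_one_div_nonneg E
      · exact le_rfl
    have h6 : 0 ≤ ∏ p ∈ primesIoc 0 ⌊Real.exp (logCut 3 N)⌋₊, (1 + 1 / (p : ℝ)) :=
      Finset.prod_nonneg fun p _ => by positivity
    rw [modelError]
    positivity
  · filter_upwards [tendsto_rootLogLog.eventually_ge_atTop 40, eventually_rootLogLog_sq,
      (tendsto_logCut 3).eventually_ge_atTop 1, tendsto_log_natCast.eventually_ge_atTop 1,
      eventually_ge_atTop 1] with N hM hsq hcut hlog hN
    have hN0 : (0 : ℝ) < N := by exact_mod_cast hN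
    set L := Real.log (Real.log N) with hL
    set k := ⌈4 * L⌉₊ with hk
    set y := ⌊Real.exp (logCut 3 N)⌋₊ with hy
    have hL1 : 1600 ≤ L := by nlinarith
    have hy1 : 1 ≤ y := (le_floor_exp_iff le_rfl _).2 (by simp; linarith)
    refine (modelError_le hy1).trans (add_le_add ?_ ?_)
    · refine mul_le_mul_of_nonneg_left (Real.exp_le_exp.2 ?_) (by norm_num)
      have h1 := (abs_le.1 (hK _ hcut)).2
      have h2 : Real.log (logCut 3 N) ≤ L := by
        refine Real.log_le_log (by linarith) ?_
        exact div_le_self (by linarith) (one_le_pow₀ (by linarith))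
      have h3 : 4 * L ≤ k := Nat.le_ceil _
      linarith
    · rw [mul_div_assoc]
      refine mul_le_mul_of_nonneg_left ?_ (by norm_num)
      have h1 : (y : ℝ) ≤ Real.exp (logCut 3 N) := Nat.floor_le (Real.exp_pos _).le
      have h2 : (k : ℝ) ≤ 4 * L + 1 := (Nat.ceil_lt_add_one (by linarith)).le
      have h3 : ((4 * k : ℕ) : ℝ) * logCut 3 N ≤ Real.log N / 2 := by
        have h4 : ((4 * k : ℕ) : ℝ) ≤ 20 * rootLogLog N ^ 2 := by push_cast; rw [hsq]; linarith
        calc ((4 * k : ℕ) : ℝ) * logCut 3 N ≤ 20 * rootLogLog N ^ 2 * logCut 3 N :=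
              mul_le_mul_of_nonneg_right h4 (by linarith)
          _ = 20 * Real.log N / rootLogLog N := by rw [logCut]; field_simp
          _ ≤ Real.log N / 2 := by
              rw [div_le_div_iff₀ (by linarith) (by norm_num)]
              nlinarith
      rw [div_le_iff₀ hN0]
      calc (y : ℝ) ^ (4 * k) ≤ Real.exp (logCut 3 N) ^ (4 * k) :=
            pow_le_pow_left₀ (by positivity) h1 _
        _ = Real.exp (((4 * k : ℕ) : ℝ) * logCut 3 N) := (Real.exp_nat_mul _ _).symm
        _ ≤ Real.exp (Real.log N / 2) := Real.exp_le_exp.2 h3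
        _ = Real.exp (-(Real.log N / 2)) * N := by
            nth_rewrite 3 [← Real.exp_log hN0]
            rw [← Real.exp_add]
            ring_nf

/-- `n` has consecutive prime factors `p < q` with `log q > T log p`. -/
def HasGap (T : ℝ) (n : ℕ) : Prop :=
  ∃ p ∈ n.primeFactors, (∃ q ∈ n.primeFactors, p < q) ∧ GapStart T p n.primeFactors

/-- The only consequences of `T ~ c log log N` that relate gaps to the cutoffs `logCut`. -/
theorem eventually_growth_bounds {T : ℕ → ℝ} {c : ℝ} (hc : 0 < c)
    (hT : Tendsto (fun N => T N / Real.log (Real.log N)) atTop (𝓝 c)) :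
    ∀ᶠ N in atTop, rootLogLog N * √(rootLogLog N) ≤ T N ∧ T N ≤ rootLogLog N ^ 3 := by
  have hsqrt : Tendsto (fun N => √(rootLogLog N)) atTop atTop :=
    Real.tendsto_sqrt_atTop.comp tendsto_rootLogLog
  filter_upwards [hT.eventually (lt_mem_nhds (half_lt_self hc)),
    hT.eventually (gt_mem_nhds (show c < 2 * c by linarith)), eventually_rootLogLog_sq,
    tendsto_rootLogLog.eventually_ge_atTop 1, tendsto_rootLogLog.eventually_ge_atTop (2 * c),
    hsqrt.eventually_ge_atTop (2 / c)] with N h1 h2 hsq hM hM2 hs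
  have hL : 0 < Real.log (Real.log N) := by nlinarith
  rw [lt_div_iff₀ hL, ← hsq] at h1
  rw [div_lt_iff₀ hL, ← hsq] at h2
  set M := rootLogLog N with hMdef
  have hM0 : 0 ≤ M := by linarith
  constructor
  · have h3 : M = √M * √M := (Real.mul_self_sqrt hM0).symm
    have h4 : 1 ≤ c / 2 * √M := by
      rw [div_le_iff₀ hc] at hs
      linarith
    have h5 : M * √M * 1 ≤ M * √M * (c / 2 * √M) :=
      mul_le_mul_of_nonneg_left h4 (mul_nonneg hM0 (Real.sqrt_nonneg _))
    have h6 : M * √M * (c / 2 * √M) = c / 2 * M ^ 2 := by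
      rw [show M * √M * (c / 2 * √M) = c / 2 * M * (√M * √M) by ring, ← h3]
      ring
    linarith
  · have : 2 * c * M ^ 2 ≤ M * M ^ 2 := mul_le_mul_of_nonneg_right hM2 (by positivity)
    nlinarith

/-- An integer with a prime factor in each window has a gap if and only if a gap starts among its
prime factors up to the smallest cutoff. -/
theorem hasGap_iff_not_noGapStart {T : ℝ} {N n : ℕ} (hn1 : 1 ≤ n) (hn : n ≤ N)
    (hM : 1 ≤ rootLogLog N) (hlog : 0 < Real.log N)
    (hT₁ : rootLogLog N * √(rootLogLog N) ≤ T) (hT₂ : T ≤ rootLogLog N ^ 3)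
    (hwin : ∀ k ∈ Finset.Icc 1 5, ∃ p ∈ primesIoc ⌊Real.exp (logCut k N)⌋₊
      ⌊Real.exp (√(rootLogLog N) * logCut k N)⌋₊, p ∣ n) :
    HasGap T n ↔ ¬ NoGapStart T 0 ⌊Real.exp (logCut 6 N)⌋₊
      (n.primeFactors ∩ primesIoc 0 ⌊Real.exp (logCut 3 N)⌋₊) := by
  set M := rootLogLog N with hMdef
  have hM0 : 0 < M := by linarith
  have hsM : 1 ≤ √M := Real.one_le_sqrt.2 hM
  have hTpos : 0 < T := lt_of_lt_of_le (by positivity) hT₁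
  have hcut0 : ∀ k, 0 < logCut k N := fun k => div_pos hlog (by positivity)
  have hcut_anti : ∀ {j k}, j ≤ k → logCut k N ≤ logCut j N := fun {j k} h =>
    div_le_div_of_nonneg_left hlog.le (by positivity) (pow_le_pow_right₀ hM h)
  have hcut_succ : ∀ k, logCut k N = M * logCut (k + 1) N := fun k => by
    rw [logCut, logCut, pow_succ, ← hMdef]; field_simp
  have hw : ∀ k ∈ Finset.Icc 1 5, ∃ r ∈ n.primeFactors,
      logCut k N < Real.log r ∧ Real.log r ≤ √M * logCut k N := by
    intro k hk
    obtain ⟨r, hr, hrn⟩ := hwin k hk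
    obtain ⟨⟨h1, h2⟩, hrp⟩ := mem_primesIoc.1 hr
    exact ⟨r, Nat.mem_primeFactors.2 ⟨hrp, hrn, by omega⟩, (floor_exp_lt_iff hrp.one_le _).1 h1,
      (le_floor_exp_iff hrp.one_le _).1 h2⟩
  have hlt : ∀ {p q : ℕ}, p.Prime → q.Prime → Real.log p < Real.log q → p < q := by
    intro p q hp hq h
    exact_mod_cast (Real.log_lt_log_iff (by exact_mod_cast hp.pos) (by exact_mod_cast hq.pos)).1 h
  constructor
  · rintro ⟨p, hp, ⟨q, hq, hpq⟩, -, hgap⟩ hno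
    have hpp := Nat.prime_of_mem_primeFactors hp
    have hqp := Nat.prime_of_mem_primeFactors hq
    have hsmall : ∀ j, j ≤ 5 → Real.log p ≤ logCut (j + 1) N := by
      intro j
      induction j with
      | zero =>
        intro _
        by_contra hcon
        push Not at hcon
        have h1 := hgap q hq hpq
        have hqN : Real.log q ≤ Real.log N := by
          refine Real.log_le_log (by exact_mod_cast hqp.pos) ?_
          exact_mod_cast (Nat.le_of_dvd hn1 (Nat.dvd_of_mem_primeFactors hq)).trans hn
        have h2 : Real.log N = M * logCut (0 + 1) N := by
          rw [← hcut_succ 0, logCut, pow_zero, div_one]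
        have h3 : M ≤ T := le_trans (le_mul_of_one_le_right hM0.le hsM) hT₁
        have h4 : M * logCut (0 + 1) N ≤ T * Real.log p :=
          mul_le_mul h3 hcon.le (hcut0 _).le hTpos.le
        linarith
      | succ j ih =>
        intro hj
        have hjp := ih (by omega)
        by_contra hcon
        push Not at hcon
        obtain ⟨r, hr, hr1, hr2⟩ := hw (j + 1) (Finset.mem_Icc.2 ⟨by omega, by omega⟩)
        have hpr := hgap r hr
          (hlt hpp (Nat.prime_of_mem_primeFactors hr) (hjp.trans_lt hr1))
        have h4 : M * √M * logCut (j + 1 + 1) N ≤ T * Real.log p :=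
          mul_le_mul hT₁ hcon.le (hcut0 _).le hTpos.le
        have h5 : √M * logCut (j + 1) N = M * √M * logCut (j + 1 + 1) N := by
          rw [hcut_succ (j + 1)]; ring
        linarith
    have h6 := hsmall 5 le_rfl
    have hpU : p ∈ n.primeFactors ∩ primesIoc 0 ⌊Real.exp (logCut 3 N)⌋₊ :=
      Finset.mem_inter.2 ⟨hp, mem_primesIoc.2 ⟨⟨hpp.pos, (le_floor_exp_iff hpp.one_le _).2
        (h6.trans (hcut_anti (by norm_num)))⟩, hpp⟩⟩
    exact hno p hpU hpp.pos ((le_floor_exp_iff hpp.one_le _).2 h6)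
      ⟨hpU, fun r hr hpr => hgap r (Finset.mem_inter.1 hr).1 hpr⟩
  · intro hno
    simp only [NoGapStart] at hno
    push Not at hno
    obtain ⟨p, hpU, -, hpz, -, hgap⟩ := hno
    have hp := (Finset.mem_inter.1 hpU).1
    have hpp := Nat.prime_of_mem_primeFactors hp
    rw [le_floor_exp_iff hpp.one_le] at hpz
    obtain ⟨r, hr, hr1, -⟩ := hw 1 (by simp)
    refine ⟨p, hp, ⟨r, hr, hlt hpp (Nat.prime_of_mem_primeFactors hr) ?_⟩, hp, fun q hq hpq => ?_⟩
    · exact (hpz.trans (hcut_anti (by norm_num))).trans_lt hr1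
    · have hqp := Nat.prime_of_mem_primeFactors hq
      by_cases hqy : q ≤ ⌊Real.exp (logCut 3 N)⌋₊
      · exact hgap q (Finset.mem_inter.2 ⟨hq, mem_primesIoc.2 ⟨⟨hqp.pos, hqy⟩, hqp⟩⟩) hpq
      · rw [not_le, floor_exp_lt_iff hqp.one_le] at hqy
        refine lt_of_le_of_lt ?_ hqy
        calc T * Real.log p ≤ M ^ 3 * logCut 6 N :=
              mul_le_mul hT₂ hpz (Real.log_natCast_nonneg p) (by positivity)
          _ = logCut 3 N := by rw [logCut, logCut, ← hMdef]; field_simp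

/-- The proportion of `n ≤ N` with a gap exceeding `T N ~ c log log N`. -/
theorem tendsto_natProb_hasGap {T : ℕ → ℝ} {c : ℝ} (hc : 0 < c)
    (hT : Tendsto (fun N => T N / Real.log (Real.log N)) atTop (𝓝 c)) :
    Tendsto (fun N => natProb N (HasGap (T N))) atTop (𝓝 (1 - Real.exp (-1 / c))) := by
  have hgrow := eventually_growth_bounds hc hT
  have hTtop : Tendsto T atTop atTop := by
    refine tendsto_atTop_mono' _ ?_ tendsto_rootLogLog
    filter_upwards [hgrow, tendsto_rootLogLog.eventually_ge_atTop 1] with N h hM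
    exact le_trans (le_mul_of_one_le_right (by linarith) (Real.one_le_sqrt.2 hM)) h.1
  set y : ℕ → ℕ := fun N => ⌊Real.exp (logCut 3 N)⌋₊ with hy
  set z : ℕ → ℕ := fun N => ⌊Real.exp (logCut 6 N)⌋₊ with hz
  have hκ : Tendsto (fun N => Real.log (logCut 6 N) / T N) atTop (𝓝 (1 / c)) := by
    have h1 : Tendsto (fun N : ℕ => Real.log (Real.log N) / T N) atTop (𝓝 (1 / c)) := by
      have := hT.inv₀ hc.ne'
      rw [one_div]
      exact this.congr fun N => by rw [inv_div]
    have h2 : Tendsto (fun N => Real.log (rootLogLog N) / rootLogLog N) atTop (𝓝 0) :=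
      Real.isLittleO_log_id_atTop.tendsto_div_nhds_zero.comp tendsto_rootLogLog
    have h3 : Tendsto (fun N => (rootLogLog N)⁻¹) atTop (𝓝 0) :=
      tendsto_rootLogLog.inv_tendsto_atTop
    have h4 := h1.mul ((h2.mul h3).const_mul 6 |>.const_sub 1)
    simp only [mul_zero, sub_zero, mul_one] at h4
    refine h4.congr' ?_
    filter_upwards [eventually_rootLogLog_sq, tendsto_rootLogLog.eventually_ge_atTop 1,
      tendsto_log_natCast.eventually_gt_atTop 0, hTtop.eventually_gt_atTop 0] with N hsq hM hl hTp
    rw [logCut, Real.log_div hl.ne' (by positivity), Real.log_pow, ← hsq]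
    have : rootLogLog N ≠ 0 := by linarith
    field_simp
    push_cast
    ring
  have hmodel : Tendsto (fun N => modelProb (primesIoc 0 (y N)) (NoGapStart (T N) 0 (z N)))
      atTop (𝓝 (Real.exp (-(1 / c)))) := by
    refine tendsto_modelProb_noGapStart (tendsto_logCut 6) hTtop hκ ?_
    filter_upwards [hgrow, tendsto_rootLogLog.eventually_ge_atTop 1,
      hTtop.eventually_gt_atTop 0] with N hg hM hTp p hp hpz
    rw [le_floor_exp_iff hp.one_le] at hpz
    refine Nat.floor_mono (Real.exp_le_exp.2 ?_)
    calc T N * Real.log p ≤ rootLogLog N ^ 3 * logCut 6 N :=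
          mul_le_mul hg.2 hpz (Real.log_natCast_nonneg p) (by positivity)
      _ = logCut 3 N := by rw [logCut, logCut]; field_simp
  have hnat : Tendsto (fun N => natProb N fun n =>
      NoGapStart (T N) 0 (z N) (n.primeFactors ∩ primesIoc 0 (y N)))
      atTop (𝓝 (Real.exp (-(1 / c)))) := by
    have hdiff : Tendsto (fun N => natProb N (fun n =>
        NoGapStart (T N) 0 (z N) (n.primeFactors ∩ primesIoc 0 (y N)))
        - modelProb (primesIoc 0 (y N)) (NoGapStart (T N) 0 (z N))) atTop (𝓝 0) := by
      refine squeeze_zero_norm' ?_ tendsto_modelError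
      filter_upwards [tendsto_loglog_natCast.eventually_gt_atTop 0, eventually_ge_atTop 1]
        with N hL hN
      exact abs_natProb_sub_modelProb_le (fun p hp => (mem_primesIoc.1 hp).2)
        (Nat.one_le_ceil_iff.2 (by linarith)) hN _
    have := hdiff.add hmodel
    rw [zero_add] at this
    exact this.congr fun N => by ring
  set bad : ℕ → ℕ → ℕ → Prop := fun k N n =>
    ∀ p ∈ primesIoc ⌊Real.exp (logCut k N)⌋₊ ⌊Real.exp (√(rootLogLog N) * logCut k N)⌋₊,
      ¬ p ∣ n with hbad
  have hbadsum : Tendsto (fun N => natProb N (bad 1 N) + natProb N (bad 2 N) + natProb N (bad 3 N)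
      + natProb N (bad 4 N) + natProb N (bad 5 N)) atTop (𝓝 0) := by
    have h := fun k (hk : 1 ≤ k) => tendsto_natProb_window_empty hk
    simpa using ((((h 1 le_rfl).add (h 2 (by norm_num))).add (h 3 (by norm_num))).add
      (h 4 (by norm_num))).add (h 5 (by norm_num))
  have hdiff : Tendsto (fun N => natProb N (HasGap (T N)) - (1 - natProb N (fun n =>
      NoGapStart (T N) 0 (z N) (n.primeFactors ∩ primesIoc 0 (y N))))) atTop (𝓝 0) := by
    refine squeeze_zero_norm' ?_ hbadsum
    filter_upwards [hgrow, tendsto_rootLogLog.eventually_ge_atTop 1,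
      tendsto_log_natCast.eventually_gt_atTop 0, eventually_ge_atTop 1] with N hg hM hl hN
    have hunion : ∀ P Q : ℕ → Prop, (∀ n, 1 ≤ n → n ≤ N → P n → Q n ∨
        ((((bad 1 N n ∨ bad 2 N n) ∨ bad 3 N n) ∨ bad 4 N n) ∨ bad 5 N n)) →
        natProb N P ≤ natProb N Q + (natProb N (bad 1 N) + natProb N (bad 2 N) + natProb N (bad 3 N)
      + natProb N (bad 4 N) + natProb N (bad 5 N)) := by
      intro P Q h
      refine (natProb_mono h).trans ((natProb_or_le _ _ _).trans (add_le_add_right ?_ _))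
      refine (natProb_or_le _ _ _).trans (add_le_add_left ?_ _)
      refine (natProb_or_le _ _ _).trans (add_le_add_left ?_ _)
      refine (natProb_or_le _ _ _).trans (add_le_add_left ?_ _)
      exact natProb_or_le _ _ _
    have hiff : ∀ n, 1 ≤ n → n ≤ N →
        ¬ ((((bad 1 N n ∨ bad 2 N n) ∨ bad 3 N n) ∨ bad 4 N n) ∨ bad 5 N n) →
        (HasGap (T N) n ↔
          ¬ NoGapStart (T N) 0 (z N) (n.primeFactors ∩ primesIoc 0 (y N))) := by
      intro n hn1 hn hnb
      refine hasGap_iff_not_noGapStart hn1 hn hM hl hg.1 hg.2 fun k hk => ?_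
      have hk' : ¬ bad k N n := by
        rw [Finset.mem_Icc] at hk
        have : k = 1 ∨ k = 2 ∨ k = 3 ∨ k = 4 ∨ k = 5 := by omega
        rcases this with rfl | rfl | rfl | rfl | rfl <;> tauto
      simp only [hbad] at hk'
      push Not at hk'
      exact hk'
    have h1 := hunion (HasGap (T N)) (fun n =>
      ¬ NoGapStart (T N) 0 (z N) (n.primeFactors ∩ primesIoc 0 (y N))) fun n hn1 hn h => by
        by_cases hb : ((((bad 1 N n ∨ bad 2 N n) ∨ bad 3 N n) ∨ bad 4 N n) ∨ bad 5 N n)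
        · exact Or.inr hb
        · exact Or.inl ((hiff n hn1 hn hb).1 h)
    have h2 := hunion (fun n =>
      ¬ NoGapStart (T N) 0 (z N) (n.primeFactors ∩ primesIoc 0 (y N))) (HasGap (T N))
      fun n hn1 hn h => by
        by_cases hb : ((((bad 1 N n ∨ bad 2 N n) ∨ bad 3 N n) ∨ bad 4 N n) ∨ bad 5 N n)
        · exact Or.inr hb
        · exact Or.inl ((hiff n hn1 hn hb).2 h)
    have h3 := natProb_add_not hN fun n =>
      NoGapStart (T N) 0 (z N) (n.primeFactors ∩ primesIoc 0 (y N))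
    rw [Real.norm_eq_abs, abs_le]
    constructor <;> linarith
  have := hdiff.add (hnat.const_sub 1)
  rw [zero_add, show -(1 / c) = -1 / c by ring] at this
  exact this.congr fun N => by ring

/-! ### The largest gap and asymptotic density -/

theorem setOf_mem_primeFactors_finite (n : ℕ) :
    (Set.ofPred fun p => p ∈ n.primeFactors).Finite := n.primeFactors.finite_toSet

theorem card_toFinset_primeFactors (n : ℕ) :
    (setOf_mem_primeFactors_finite n).toFinset.card = n.primeFactors.card := by
  congr 1
  ext p
  simp

theorem kthPrimeFactor_mem {n j : ℕ} (h1 : 1 ≤ j) (h2 : j ≤ n.primeFactors.card) :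
    kthPrimeFactor j n ∈ n.primeFactors :=
  Nat.nth_mem_of_lt_card (p := fun p => p ∈ n.primeFactors) (setOf_mem_primeFactors_finite n)
    (by rw [card_toFinset_primeFactors]; omega)

theorem kthPrimeFactor_lt_succ {n j : ℕ} (h1 : 1 ≤ j) (h2 : j < n.primeFactors.card) :
    kthPrimeFactor j n < kthPrimeFactor (j + 1) n :=
  Nat.nth_lt_nth_of_lt_card (setOf_mem_primeFactors_finite n) (by omega)
    (by rw [card_toFinset_primeFactors]; omega)

theorem kthPrimeFactor_succ_le {n j q : ℕ} (h1 : 1 ≤ j) (hq : q ∈ n.primeFactors)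
    (h : kthPrimeFactor j n < q) : kthPrimeFactor (j + 1) n ≤ q := by
  by_contra hcon
  push Not at hcon
  obtain ⟨i, rfl⟩ : ∃ i, j = i + 1 := ⟨j - 1, by omega⟩
  have := Nat.le_nth_of_lt_nth_succ (p := fun p => p ∈ n.primeFactors) (k := i) hcon hq
  exact absurd h (not_lt.2 this)

theorem exists_kthPrimeFactor_eq {n p q : ℕ} (hp : p ∈ n.primeFactors) (hq : q ∈ n.primeFactors)
    (hpq : p < q) : ∃ j ∈ Finset.Ico 1 n.primeFactors.card, kthPrimeFactor j n = p := by
  have hf := setOf_mem_primeFactors_finite n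
  obtain ⟨i, hi, rfl⟩ := Nat.exists_lt_card_finite_nth_eq hf hp
  obtain ⟨i', hi', rfl⟩ := Nat.exists_lt_card_finite_nth_eq hf hq
  have := Nat.lt_of_nth_lt_nth_of_lt_card hf hpq hi
  rw [card_toFinset_primeFactors] at hi'
  exact ⟨i + 1, Finset.mem_Ico.2 ⟨by omega, by omega⟩, rfl⟩

theorem lt_exp_maxLogGap_iff {T : ℝ} (hT : 1 ≤ T) (n : ℕ) :
    T < Real.exp (maxLogGap n) ↔ HasGap T n := by
  have hT0 : 0 < T := by linarith
  have hstep : ∀ j ∈ Finset.Ico 1 n.primeFactors.card,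
      (Real.log T < Real.log (Real.log (kthPrimeFactor (j + 1) n) /
        Real.log (kthPrimeFactor j n)) ↔
      T * Real.log (kthPrimeFactor j n) < Real.log (kthPrimeFactor (j + 1) n)) := by
    intro j hj
    rw [Finset.mem_Ico] at hj
    have hpos : ∀ p ∈ n.primeFactors, 0 < Real.log (p : ℝ) := fun p hp =>
      Real.log_pos (by exact_mod_cast (Nat.prime_of_mem_primeFactors hp).one_lt)
    have h1 := hpos _ (kthPrimeFactor_mem hj.1 hj.2.le)
    have h2 := hpos _ (kthPrimeFactor_mem (n := n) (j := j + 1) (by omega) (by omega))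
    rw [Real.log_lt_log_iff hT0 (div_pos h2 h1), lt_div_iff₀ h1]
  rw [← Real.log_lt_iff_lt_exp hT0, maxLogGap]
  constructor
  · intro h
    split_ifs at h with hne
    · rw [Finset.lt_sup'_iff] at h
      obtain ⟨j, hj, h⟩ := h
      rw [hstep j hj] at h
      rw [Finset.mem_Ico] at hj
      refine ⟨kthPrimeFactor j n, kthPrimeFactor_mem hj.1 hj.2.le, ⟨kthPrimeFactor (j + 1) n,
        kthPrimeFactor_mem (by omega) (by omega), kthPrimeFactor_lt_succ hj.1 hj.2⟩,
        kthPrimeFactor_mem hj.1 hj.2.le, fun q hq hpq => h.trans_le ?_⟩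
      have hmem := kthPrimeFactor_mem (n := n) (j := j + 1) (by omega) (by omega)
      exact Real.log_le_log (by exact_mod_cast (Nat.prime_of_mem_primeFactors hmem).pos)
        (by exact_mod_cast kthPrimeFactor_succ_le hj.1 hq hpq)
    · exact absurd h (not_lt.2 (Real.log_nonneg hT))
  · rintro ⟨p, hp, ⟨q, hq, hpq⟩, -, hgap⟩
    obtain ⟨j, hj, rfl⟩ := exists_kthPrimeFactor_eq hp hq hpq
    have hne : (Finset.Ico 1 n.primeFactors.card).Nonempty := ⟨j, hj⟩
    rw [dif_pos hne, Finset.lt_sup'_iff]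
    refine ⟨j, hj, (hstep j hj).2 ?_⟩
    rw [Finset.mem_Ico] at hj
    exact hgap _ (kthPrimeFactor_mem (by omega) (by omega)) (kthPrimeFactor_lt_succ hj.1 hj.2)

theorem hasAsymptoticDensity_iff (P : ℕ → Prop) (d : ℝ) :
    HasAsymptoticDensity {n | P n} d ↔ Tendsto (fun N => natProb N P) atTop (𝓝 d) := by
  simp only [HasAsymptoticDensity, natProb_eq_ncard_div]

theorem natProb_le_div (N m : ℕ) : natProb N (fun n => n ≤ m) ≤ (m : ℝ) / N := by
  classical
  refine div_le_div_of_nonneg_right ?_ (Nat.cast_nonneg N)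
  have h : (∑ n ∈ Finset.Ioc 0 N, if n ≤ m then (1 : ℝ) else 0) ≤
      ∑ n ∈ Finset.Ioc 0 m, (1 : ℝ) := by
    rw [← Finset.sum_filter]
    refine Finset.sum_le_sum_of_subset_of_nonneg (fun n hn => ?_) fun _ _ _ => zero_le_one
    rw [Finset.mem_filter, Finset.mem_Ioc] at hn
    exact Finset.mem_Ioc.2 ⟨hn.1.1, hn.2⟩
  refine le_trans (le_of_eq ?_) (h.trans_eq (by simp))
  exact Finset.sum_congr rfl fun n _ => by congr

theorem tendsto_natProb_le_const (m : ℕ) :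
    Tendsto (fun N => natProb N (fun n => n ≤ m)) atTop (𝓝 0) :=
  squeeze_zero (fun _ => natProb_nonneg _ _) (fun N => natProb_le_div N m)
    (tendsto_const_div_atTop_nhds_zero_nat _)

theorem tendsto_natProb_le_sqrt :
    Tendsto (fun N => natProb N (fun n => n ≤ N.sqrt)) atTop (𝓝 0) := by
  have h : Tendsto (fun N : ℕ => (√(N : ℝ))⁻¹) atTop (𝓝 0) :=
    (Real.tendsto_sqrt_atTop.comp tendsto_natCast_atTop_atTop).inv_tendsto_atTop
  refine squeeze_zero (fun _ => natProb_nonneg _ _) (fun N => (natProb_le_div N _).trans ?_) h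
  calc ((N.sqrt : ℕ) : ℝ) / N ≤ √(N : ℝ) / N :=
        div_le_div_of_nonneg_right Real.nat_sqrt_le_real_sqrt (Nat.cast_nonneg N)
    _ = (√(N : ℝ))⁻¹ := Real.sqrt_div_self

/-- Sandwiching up to events of vanishing probability. -/
theorem tendsto_natProb_of_sandwich {P Q S : ℕ → ℕ → Prop} {R : ℕ → Prop} {d : ℝ}
    (hP : Tendsto (fun N => natProb N (P N)) atTop (𝓝 d))
    (hQ : Tendsto (fun N => natProb N (Q N)) atTop (𝓝 d))
    (hS : Tendsto (fun N => natProb N (S N)) atTop (𝓝 0))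
    (h₁ : ∀ᶠ N in atTop, ∀ n, n ≤ N → P N n → R n ∨ S N n)
    (h₂ : ∀ᶠ N in atTop, ∀ n, n ≤ N → R n → Q N n ∨ S N n) :
    Tendsto (fun N => natProb N R) atTop (𝓝 d) := by
  have hlo := hP.sub hS
  have hup := hQ.add hS
  rw [sub_zero] at hlo
  rw [add_zero] at hup
  refine tendsto_of_tendsto_of_tendsto_of_le_of_le' hlo hup ?_ ?_
  · filter_upwards [h₁] with N h
    have := (natProb_mono fun n _ hn => h n hn).trans (natProb_or_le N R (S N))
    linarith
  · filter_upwards [h₂] with N h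
    exact (natProb_mono fun n _ hn => h n hn).trans (natProb_or_le N (Q N) (S N))

theorem iterLog_two (n : ℕ) : iterLog 2 n = Real.log (Real.log n) := rfl

theorem tendsto_natProb_exp_maxLogGap {c : ℝ} (hc : 0 < c) :
    Tendsto (fun N => natProb N fun n => Real.exp (maxLogGap n) > c * iterLog 2 n) atTop
      (𝓝 (1 - Real.exp (-1 / c))) := by
  have hL := tendsto_loglog_natCast
  have h1 : Tendsto (fun N : ℕ => c * Real.log (Real.log N) / Real.log (Real.log N)) atTop
      (𝓝 c) := by
    refine tendsto_const_nhds.congr' ?_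
    filter_upwards [hL.eventually_gt_atTop 0] with N h
    field_simp
  have h2 : Tendsto (fun N : ℕ => c * (Real.log (Real.log N) - Real.log 2) /
      Real.log (Real.log N)) atTop (𝓝 c) := by
    have := h1.sub ((hL.const_div_atTop (c * Real.log 2)))
    rw [sub_zero] at this
    exact this.congr fun N => by ring
  -- For `√N < n ≤ N`, `log log n` lies between `log log N - log 2` and `log log N`.
  refine tendsto_natProb_of_sandwich (tendsto_natProb_hasGap hc h1) (tendsto_natProb_hasGap hc h2)
    tendsto_natProb_le_sqrt ?_ ?_
  · filter_upwards [hL.eventually_ge_atTop (1 / c), tendsto_log_natCast.eventually_gt_atTop 0]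
      with N hN hl n hn hgap
    rw [div_le_iff₀ hc] at hN
    by_cases hs : n ≤ N.sqrt
    · exact Or.inr hs
    left
    rw [not_le, Nat.sqrt_lt] at hs
    have hn0 : 0 < n := by rcases Nat.eq_zero_or_pos n with rfl | h <;> omega
    have hn0' : (0 : ℝ) < n := by exact_mod_cast hn0
    have hlog : Real.log N ≤ Real.log n + Real.log n := by
      rw [← Real.log_mul hn0'.ne' hn0'.ne']
      refine Real.log_le_log ?_ (by exact_mod_cast hs.le)
      exact_mod_cast hn0.trans_le hn
    rw [← lt_exp_maxLogGap_iff (by linarith)] at hgap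
    refine lt_of_le_of_lt ?_ hgap
    rw [iterLog_two]
    refine mul_le_mul_of_nonneg_left (Real.log_le_log (by linarith) ?_) hc.le
    exact Real.log_le_log hn0' (by exact_mod_cast hn)
  · filter_upwards [hL.eventually_ge_atTop (1 / c + Real.log 2),
      tendsto_log_natCast.eventually_gt_atTop 0] with N hN hl n hn hgap
    by_cases hs : n ≤ N.sqrt
    · exact Or.inr hs
    left
    rw [not_le, Nat.sqrt_lt] at hs
    have hn0 : 0 < n := by rcases Nat.eq_zero_or_pos n with rfl | h <;> omega
    have hn0' : (0 : ℝ) < n := by exact_mod_cast hn0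
    have hlog : Real.log N ≤ Real.log n + Real.log n := by
      rw [← Real.log_mul hn0'.ne' hn0'.ne']
      refine Real.log_le_log ?_ (by exact_mod_cast hs.le)
      exact_mod_cast hn0.trans_le hn
    have h3 : 1 / c ≤ Real.log (Real.log N) - Real.log 2 := by linarith
    rw [div_le_iff₀ hc] at h3
    rw [← lt_exp_maxLogGap_iff (by linarith)]
    refine lt_of_le_of_lt ?_ hgap
    rw [iterLog_two, ← Real.log_div hl.ne' (by norm_num)]
    exact mul_le_mul_of_nonneg_left (Real.log_le_log (by linarith) (by linarith)) hc.le

theorem maxLogGap_gt_iff {c : ℝ} (hc : 0 < c) {n : ℕ} (hn : 3 ≤ n) :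
    maxLogGap n > iterLog 3 n - Real.log (1 / c) ↔
      Real.exp (maxLogGap n) > c * iterLog 2 n := by
  have hn' : (3 : ℝ) ≤ n := by exact_mod_cast hn
  have h1 : 1 < Real.log n := by
    rw [Real.lt_log_iff_exp_lt (by linarith)]
    linarith [Real.exp_one_lt_d9]
  have h2 : 0 < iterLog 2 n := Real.log_pos h1
  have h3 : iterLog 3 n - Real.log (1 / c) = Real.log (c * iterLog 2 n) := by
    rw [Real.log_mul hc.ne' h2.ne', one_div, Real.log_inv]
    change Real.log (iterLog 2 n) - _ = _
    ring
  rw [h3, gt_iff_lt, gt_iff_lt, Real.log_lt_iff_lt_exp (by positivity)]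

theorem tendsto_natProb_maxLogGap {c : ℝ} (hc : 0 < c) :
    Tendsto (fun N => natProb N fun n => maxLogGap n > iterLog 3 n - Real.log (1 / c)) atTop
      (𝓝 (1 - Real.exp (-1 / c))) := by
  have h := tendsto_natProb_exp_maxLogGap hc
  refine tendsto_natProb_of_sandwich h h (tendsto_natProb_le_const 2) ?_ ?_ <;>
  · refine Eventually.of_forall fun N n _ hn => ?_
    by_cases hn2 : n ≤ 2
    · exact Or.inr hn2
    · left
      have := maxLogGap_gt_iff hc (n := n) (by omega)
      tauto

theorem holdsForAlmostAll_abs_le {ξ : ℕ → ℝ} (hξ : Tendsto ξ atTop atTop) :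
    HoldsForAlmostAll fun n : ℕ =>
      iterLog 3 n - ξ n ≤ maxLogGap n ∧ maxLogGap n ≤ iterLog 3 n + ξ n := by
  rw [HoldsForAlmostAll, hasAsymptoticDensity_iff]
  set P : ℕ → Prop := fun n =>
    iterLog 3 n - ξ n ≤ maxLogGap n ∧ maxLogGap n ≤ iterLog 3 n + ξ n with hP
  have hbad : Tendsto (fun N => natProb N fun n => ¬ P n) atTop (𝓝 0) := by
    rw [tendsto_order]
    refine ⟨fun a ha => Eventually.of_forall fun N => ha.trans_le (natProb_nonneg _ _),
      fun ε hε => ?_⟩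
    -- The exceptional densities `1 - exp (-1 / C)` and `exp (-1 / c)` are at most `ε / 8`
    -- for `C = 8 / ε` and `c = ε / 8`.
    have hC : 0 < 8 / ε := by positivity
    have hc : 0 < ε / 8 := by positivity
    have hupper := tendsto_natProb_maxLogGap hC
    have hlower := tendsto_natProb_maxLogGap hc
    have e1 : 1 - Real.exp (-1 / (8 / ε)) < ε / 4 := by
      have h := Real.add_one_le_exp (-1 / (8 / ε))
      have h2 : -1 / (8 / ε) = -(ε / 8) := by field_simp
      linarith
    have e2 : 1 - ε / 4 < 1 - Real.exp (-1 / (ε / 8)) := by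
      have h2 : -1 / (ε / 8) = -(8 / ε) := by field_simp
      rw [h2, Real.exp_neg]
      have h := Real.add_one_le_exp (8 / ε)
      have h3 : (Real.exp (8 / ε))⁻¹ ≤ (8 / ε)⁻¹ := inv_anti₀ hC (by linarith)
      rw [inv_div] at h3
      linarith
    obtain ⟨m, hm⟩ := eventually_atTop.1
      (hξ.eventually_ge_atTop (max (Real.log (8 / ε)) (Real.log (1 / (ε / 8)))))
    filter_upwards [hupper.eventually (gt_mem_nhds e1), hlower.eventually (lt_mem_nhds e2),
      (tendsto_natProb_le_const m).eventually (gt_mem_nhds (show (0 : ℝ) < ε / 4 by positivity)),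
      eventually_ge_atTop 1] with N h1 h2 h3 hN
    have h4 := natProb_add_not hN fun n => maxLogGap n > iterLog 3 n - Real.log (1 / (ε / 8))
    have h5 : natProb N (fun n => ¬ P n) ≤
        natProb N (fun n => n ≤ m) +
          (natProb N (fun n => maxLogGap n > iterLog 3 n - Real.log (1 / (8 / ε))) +
            natProb N (fun n => ¬ (maxLogGap n > iterLog 3 n - Real.log (1 / (ε / 8))))) := by
      refine le_trans (natProb_mono fun n _ _ hn => ?_) ((natProb_or_le _ _ _).trans
        (add_le_add_right (natProb_or_le _ _ _) _))
      by_cases hnm : n ≤ m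
      · exact Or.inl hnm
      · right
        have hx := hm n (by omega)
        have hx1 := (le_max_left _ _).trans hx
        have hx2 := (le_max_right _ _).trans hx
        rw [hP] at hn
        rw [one_div, Real.log_inv]
        by_contra hcon
        push Not at hcon
        exact hn ⟨by linarith [hcon.2], by linarith [hcon.1]⟩
    linarith
  have := hbad.const_sub 1
  rw [sub_zero] at this
  refine this.congr' ?_
  filter_upwards [eventually_ge_atTop 1] with N hN
  linarith [natProb_add_not hN P]

theorem theorem1 :
    (∀ c : ℝ, 0 < c →
      HasAsymptoticDensity {n : ℕ | maxLogGap n > iterLog 3 n - Real.log (1 / c)}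
        (1 - Real.exp (-1 / c)) ∧
      HasAsymptoticDensity {n : ℕ | Real.exp (maxLogGap n) > c * iterLog 2 n}
        (1 - Real.exp (-1 / c)) ∧
      ∀ n : ℕ, 3 ≤ n →
        (maxLogGap n > iterLog 3 n - Real.log (1 / c) ↔
          Real.exp (maxLogGap n) > c * iterLog 2 n)) ∧
    (∀ ξ : ℕ → ℝ, Tendsto ξ atTop atTop →
      HoldsForAlmostAll fun n : ℕ =>
        iterLog 3 n - ξ n ≤ maxLogGap n ∧ maxLogGap n ≤ iterLog 3 n + ξ n) :=
  ⟨fun _ hc => ⟨(hasAsymptoticDensity_iff _ _).2 (tendsto_natProb_maxLogGap hc),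
    (hasAsymptoticDensity_iff _ _).2 (tendsto_natProb_exp_maxLogGap hc),
    fun _ hn => maxLogGap_gt_iff hc hn⟩, fun _ hξ => holdsForAlmostAll_abs_le hξ⟩
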